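/- Throughout, $\log=\log_2$. Let $\mathcal H$ be a finite-dimensional complex Hilbert space and let $\rho,\sigma$ be density operators on $\mathcal H$ (positive semidefinite operators of unit trace) with $\operatorname{supp}\rho\subseteq\operatorname{supp}\sigma$. For density operators $\omega,\tau$ let $F(\omega,\tau)=\operatorname{Tr}\sqrt{\sqrt\omega\,\tau\sqrt\omega}$ be the fidelity and $d_{\mathrm{op}}(\omega,\tau)=\sqrt{1-F(\omega,\tau)^2}$. For positive semidefinite operators let $D_{\max}(\omega\|\tau)=\inf\{\gamma\in\mathbb R:\ \omega\le 2^{\gamma}\tau\}$ (with value $+\infty$ if there is no such $\gamma$), and for a density operator $\omega$ let $$D^{\varepsilon}_{\max}(\omega\|\tau)=\min\{D_{\max}(\bar\omega\|\tau):\ \bar\omega\ge 0,\ \operatorname{Tr}\bar\omega=1,\ d_{\mathrm{op}}(\bar\omega,\omega)\le\varepsilon\}.$$ Let $D(\rho\|\sigma)=\operatorname{Tr}\rho(\log\rho-\log\sigma)$ be the relative entropy and $$\eta=1+\operatorname{Tr}\rho^{3/2}\sigma^{-1/2}+\operatorname{Tr}\rho^{1/2}\sigma^{1/2},$$ where logarithms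 and negative powers of operators are taken on their supports. Then for all real $0<\varepsilon<\varepsilon'<1$ and every integer $n\ge 1$, $$\frac1n D^{\varepsilon}_{\max}\left(\rho^{\otimes n}\|\sigma^{\otimes n}\right)\le D(\rho\|\sigma)+\frac{1}{\sqrt n}\,4\sqrt2\,(\log\eta)\,\log\left(1-\sqrt{1-\varepsilon^2}\right)^{-1},$$ $$\frac1n D^{\varepsilon}_{\max}\left(\rho^{\otimes n}\|\sigma^{\otimes n}\right)\ge D(\rho\|\sigma)-\frac{1}{\sqrt n}\,4\sqrt2\,(\log\eta)\,\log(1-\varepsilon')^{-1}-\frac1n\log\frac{1}{\varepsilon'-\varepsilon}.$$ (Here $\log x^{-1}$ means $\log(x^{-1})$.) In particular, for every $\varepsilon\in(0,1)$, $$\lim_{n\to\infty}\frac1n D^{\varepsilon}_{\max}\left(\rho^{\otimes n}\|\sigma^{\otimes n}\right)=D(\rho\|\sigma).$$ -/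

import Mathlib

open Filter Topology
open scoped ComplexOrder MatrixOrder

noncomputable section

namespace QAEP

/-! Operators on a finite-dimensional complex Hilbert space are complex square matrices indexed by
a finite type `ι` (an orthonormal basis); `A ≤ B` is the Loewner order, i.e. `B - A` is positive
semidefinite. Functions of Hermitian matrices are given by the continuous functional calculus.
All logarithms are to base `2`. -/

variable {ι : Type*} [Fintype ι] [DecidableEq ι]

/-- Density matrices: positive semidefinite operators of unit trace. -/
def IsState (ρ : Matrix ι ι ℂ) : Prop :=
  ρ.PosSemidef ∧ ρ.trace = 1

/-- The support of a positive semidefinite operator, i.e. the orthogonal complement of its kernel,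
which is its range. -/
def supp (A : Matrix ι ι ℂ) : Submodule ℂ (ι → ℂ) :=
  LinearMap.range A.mulVecLin

/-- The binary logarithm of a positive semidefinite operator, taken on its support
(`Real.logb 2 0 = 0`). -/
def matLog (A : Matrix ι ι ℂ) : Matrix ι ι ℂ :=
  cfc (Real.logb 2) A

open Classical in
/-- The relative entropy `D(ρ‖σ) = Tr ρ (log ρ - log σ)` if `supp ρ ⊆ supp σ`, and `+∞` otherwise.
-/
def relEntropy (ρ σ : Matrix ι ι ℂ) : EReal :=
  if supp ρ ≤ supp σ then (((ρ * (matLog ρ - matLog σ)).trace.re : ℝ) : EReal) else ⊤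

/-- The fidelity `F(ρ, σ) = Tr √(√ρ σ √ρ)`. -/
def fidelity (ρ σ : Matrix ι ι ℂ) : ℝ :=
  (CFC.sqrt (CFC.sqrt ρ * σ * CFC.sqrt ρ)).trace.re

/-- The distance of optimal purifications `√((Tr ρ + Tr σ)² / 4 - F(ρ, σ)²)`; it is the sine
distance `√(1 - F(ρ, σ)²)` if `ρ` and `σ` are states. -/
def dOp (ρ σ : Matrix ι ι ℂ) : ℝ :=
  Real.sqrt ((ρ.trace.re + σ.trace.re) ^ 2 / 4 - fidelity ρ σ ^ 2)

/-- The `ε`-ball of states around `ρ`. -/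
def ball (ε : ℝ) (ρ : Matrix ι ι ℂ) : Set (Matrix ι ι ℂ) :=
  {ω | IsState ω ∧ dOp ω ρ ≤ ε}

/-- The max-relative entropy `inf {γ : ρ ≤ 2 ^ γ σ}`, with value `+∞` if there is no such real
number `γ`. -/
def dMax (ρ σ : Matrix ι ι ℂ) : EReal :=
  ⨅ (γ : ℝ) (_ : ρ ≤ ((2 : ℝ) ^ γ) • σ), (γ : EReal)

/-- The `ε`-smooth max-relative entropy: the smallest value of `dMax ω σ` over the states `ω` of
the `ε`-ball around `ρ`. -/
def dMaxSmooth (ε : ℝ) (ρ σ : Matrix ι ι ℂ) : EReal :=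
  ⨅ ω ∈ ball ε ρ, dMax ω σ

/-- The `n`-fold tensor power of an operator, on the space with the product basis. -/
def tensorPow (A : Matrix ι ι ℂ) (n : ℕ) : Matrix (Fin n → ι) (Fin n → ι) ℂ :=
  Matrix.of fun i j => ∏ k, A (i k) (j k)

/-- `η = 1 + Tr ρ^{3/2} σ^{-1/2} + Tr ρ^{1/2} σ^{1/2}`. The powers are those of the functional
calculus, with `0 ^ s = 0` for `s ≠ 0`: the negative power is taken on the support. -/
def eta (ρ σ : Matrix ι ι ℂ) : ℝ :=
  1 + (ρ ^ (3 / 2 : ℝ) * σ ^ (-1 / 2 : ℝ)).trace.re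
    + (ρ ^ (1 / 2 : ℝ) * σ ^ (1 / 2 : ℝ)).trace.re

end QAEP

end

noncomputable section

namespace QAEP

open Matrix

variable {ι : Type*} [Fintype ι] [DecidableEq ι]

/-! ### Operators diagonal in a given orthonormal basis -/

/-! Let r, s be the eigenvalues of ρ, σ and U the overlap unitary of their eigenbases. The weights
P(i,j) = r_i |U i j|² form a probability distribution (Nussbaum–Szkoła). Under it the ratio X = ln
r_i - ln s_j has mean D(ρ‖σ) ln 2 and satisfies E[2 cosh(X/2)] = η - 1. For tensor powers P becomes
a product and X a sum of independent copies, fluctuating on the scale N = √n ln η (`subExp_sum`). It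
remains to read the smooth entropy off P although ρ and σ need not commute, and to control the
deviations of X with the stated constants.

Achievability (`exists_state_fidelity`): the entrywise product of U with the kernel min(a,b)/√(ab)
is a contraction, by the Schur product theorem. Inserted between √(lam σ) and √ρ, it gives an
operator A with A A* ≤ lam σ whose overlap with √ρ is a multiple of the classical quantity m = E
min(1, μ s/r). Normalising A A* gives a state of fidelity at least √(lam/μ) m or √m.

Converse (`fidelity_le_of_le`): if ω ≤ μ σ, the fidelity of ω and ρ is at most the Bhattacharyya
overlap of P with a subnormalised distribution on the same pairs, which gives mass at most μ/lam to
any event on which lam s ≤ r.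

Deviations: both bounds ask for lower bounds on the distribution function of the centred X at
distance about 8N ln(1/(1-f)). For f ≥ 1/4 Chernoff's bound suffices. For small f the distance is
only about 8Nf and Chernoff is void; instead, were the distribution function small on a long
interval [0, T], centring would force a large mean negative part, contradicting the exponential
moment or the variance (`exists_cdf_ge_aux`, `exists_cdf_ge_aux'`). -/

/-- The operator `V diag(f) V*`. -/
def diagConj (V : Matrix ι ι ℂ) (f : ι → ℝ) : Matrix ι ι ℂ :=
  V * diagonal (fun i => (f i : ℂ)) * Vᴴ

lemma diagConj_isHermitian (V : Matrix ι ι ℂ) (f : ι → ℝ) : (diagConj V f)ᴴ = diagConj V f := by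
  have : diagonal (star fun i => (f i : ℂ)) = diagonal (fun i => (f i : ℂ)) := by
    congr 1; ext i; simp
  simp only [diagConj, conjTranspose_mul, conjTranspose_conjTranspose, diagonal_conjTranspose,
    Matrix.mul_assoc, this]

lemma diagConj_posSemidef (V : Matrix ι ι ℂ) {f : ι → ℝ} (hf : ∀ i, 0 ≤ f i) :
    (diagConj V f).PosSemidef := by
  refine PosSemidef.mul_mul_conjTranspose_same ?_ V
  exact PosSemidef.diagonal fun i => by simpa using hf i

lemma diagConj_mul {V : Matrix ι ι ℂ} (hV : Vᴴ * V = 1) (f g : ι → ℝ) :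
    diagConj V f * diagConj V g = diagConj V (fun i => f i * g i) := by
  have : diagConj V f * diagConj V g
      = V * diagonal (fun i => (f i : ℂ)) * (Vᴴ * V) * diagonal (fun i => (g i : ℂ)) * Vᴴ := by
    simp only [diagConj, Matrix.mul_assoc]
  rw [this, hV, Matrix.mul_one, Matrix.mul_assoc V, diagonal_mul_diagonal, diagConj]
  congr 3
  ext i
  simp

lemma diagConj_sub (V : Matrix ι ι ℂ) (f g : ι → ℝ) :
    diagConj V f - diagConj V g = diagConj V (fun i => f i - g i) := by
  simp only [diagConj, ← Matrix.sub_mul, ← Matrix.mul_sub, diagonal_sub]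
  simp

lemma diagConj_smul (V : Matrix ι ι ℂ) (c : ℝ) (f : ι → ℝ) :
    c • diagConj V f = diagConj V (fun i => c * f i) := by
  have : diagonal (fun i => ((c * f i : ℝ) : ℂ)) = c • diagonal (fun i => (f i : ℂ)) := by
    ext i j
    by_cases h : i = j <;> simp [h]
  rw [diagConj, diagConj, this, Matrix.mul_smul, Matrix.smul_mul]

lemma diagConj_one {V : Matrix ι ι ℂ} (hV : Vᴴ * V = 1) : diagConj V (fun _ => 1) = 1 := by
  have : diagonal (fun _ : ι => ((1 : ℝ) : ℂ)) = 1 := by simp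
  rw [diagConj, this, Matrix.mul_one, mul_eq_one_comm.mp hV]

lemma diagConj_trace {V : Matrix ι ι ℂ} (hV : Vᴴ * V = 1) (f : ι → ℝ) :
    (diagConj V f).trace = ((∑ i, f i : ℝ) : ℂ) := by
  rw [diagConj, Matrix.trace_mul_comm, ← Matrix.mul_assoc, hV, Matrix.one_mul, trace_diagonal]
  push_cast
  rfl

lemma sqrt_diagConj {V : Matrix ι ι ℂ} (hV : Vᴴ * V = 1) {f : ι → ℝ} (hf : ∀ i, 0 ≤ f i) :
    CFC.sqrt (diagConj V f) = diagConj V (fun i => √(f i)) := by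
  refine CFC.sqrt_unique ?_ ?_
  · rw [diagConj_mul hV]
    congr 1
    ext i
    exact Real.mul_self_sqrt (hf i)
  · exact nonneg_iff_posSemidef.mpr (diagConj_posSemidef V fun i => Real.sqrt_nonneg _)

/-- Spectral theorem, with the functional calculus. -/
lemma exists_diagConj {A : Matrix ι ι ℂ} (hA : A.IsHermitian) :
    ∃ (V : Matrix ι ι ℂ) (r : ι → ℝ), Vᴴ * V = 1 ∧ A = diagConj V r ∧
      ∀ f : ℝ → ℝ, cfc f A = diagConj V (fun i => f (r i)) := by
  refine ⟨hA.eigenvectorUnitary, hA.eigenvalues, ?_, ?_, fun f => ?_⟩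
  · exact Unitary.coe_star_mul_self _
  · conv_lhs => rw [hA.spectral_theorem]
    rfl
  · rw [hA.cfc_eq]
    rfl

lemma eigenvalues_nonneg_of_diagConj {V : Matrix ι ι ℂ} (hV : Vᴴ * V = 1) {r : ι → ℝ}
    (h : (diagConj V r).PosSemidef) (i : ι) : 0 ≤ r i := by
  have h1 := (h.conjTranspose_mul_mul_same V).diag_nonneg (i := i)
  have h2 : Vᴴ * diagConj V r * V = diagonal (fun i => (r i : ℂ)) := by
    have : Vᴴ * diagConj V r * V = (Vᴴ * V) * diagonal (fun i => (r i : ℂ)) * (Vᴴ * V) := by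
      simp only [diagConj, Matrix.mul_assoc]
    rw [this, hV, Matrix.one_mul, Matrix.mul_one]
  rw [h2, diagonal_apply_eq] at h1
  exact_mod_cast h1

/-- Traces of products in terms of the overlaps of the two bases. -/
lemma trace_diagConj_mul (V V' : Matrix ι ι ℂ) (f g : ι → ℝ) :
    (diagConj V f * diagConj V' g).trace.re
      = ∑ i, ∑ j, f i * g j * Complex.normSq ((Vᴴ * V') i j) := by
  set U := Vᴴ * V' with hU
  have h1 : (diagConj V f * diagConj V' g).trace
      = (diagonal (fun i => (f i : ℂ)) * U * diagonal (fun i => (g i : ℂ)) * Uᴴ).trace := by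
    have e1 : diagConj V f * diagConj V' g = V * (diagonal (fun i => (f i : ℂ)) *
        (U * diagonal (fun i => (g i : ℂ)) * V'ᴴ)) := by
      simp only [diagConj, hU, Matrix.mul_assoc]
    have e2 : Uᴴ = V'ᴴ * V := by simp [hU]
    rw [e1, Matrix.trace_mul_comm, e2]
    simp only [Matrix.mul_assoc]
  rw [h1, Matrix.trace, Complex.re_sum]
  refine Finset.sum_congr rfl fun i _ => ?_
  rw [Matrix.diag_apply, Matrix.mul_apply, Complex.re_sum]
  refine Finset.sum_congr rfl fun j _ => ?_
  rw [Matrix.mul_diagonal, Matrix.diagonal_mul, conjTranspose_apply]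
  have : (f i : ℂ) * U i j * (g j : ℂ) * star (U i j)
      = ((f i * g j * Complex.normSq (U i j) : ℝ) : ℂ) := by
    have := Complex.mul_conj (U i j)
    push_cast
    rw [← this]
    simp only [Complex.star_def]
    ring
  rw [this, Complex.ofReal_re]

/-! ### Tensor powers -/

lemma tensorPow_mul (A B : Matrix ι ι ℂ) (n : ℕ) :
    tensorPow (A * B) n = tensorPow A n * tensorPow B n := by
  ext I J
  simp only [tensorPow, of_apply, Matrix.mul_apply, ← Finset.prod_mul_distrib]
  rw [Finset.prod_univ_sum]
  simp

lemma tensorPow_conjTranspose (A : Matrix ι ι ℂ) (n : ℕ) :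
    tensorPow Aᴴ n = (tensorPow A n)ᴴ := by
  ext I J
  simp [tensorPow]

lemma tensorPow_diagonal (f : ι → ℂ) (n : ℕ) :
    tensorPow (diagonal f) n = diagonal (fun I : Fin n → ι => ∏ k, f (I k)) := by
  ext I J
  by_cases h : I = J
  · subst h
    simp [tensorPow]
  · obtain ⟨k, hk⟩ := Function.ne_iff.mp h
    rw [diagonal_apply_ne _ h]
    simp only [tensorPow, of_apply]
    exact Finset.prod_eq_zero (Finset.mem_univ k) (diagonal_apply_ne _ hk)

lemma tensorPow_diagConj (V : Matrix ι ι ℂ) (f : ι → ℝ) (n : ℕ) :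
    tensorPow (diagConj V f) n
      = diagConj (tensorPow V n) (fun I : Fin n → ι => ∏ k, f (I k)) := by
  rw [diagConj, tensorPow_mul, tensorPow_mul, tensorPow_conjTranspose, tensorPow_diagonal, diagConj]
  push_cast
  rfl

lemma tensorPow_unitary {V : Matrix ι ι ℂ} (hV : Vᴴ * V = 1) (n : ℕ) :
    (tensorPow V n)ᴴ * tensorPow V n = 1 := by
  rw [← tensorPow_conjTranspose, ← tensorPow_mul, hV, ← diagonal_one, tensorPow_diagonal]
  simp

/-! ### Contractions -/

lemma conj_le_conj {A B : Matrix ι ι ℂ} (h : A ≤ B) (C : Matrix ι ι ℂ) :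
    C * A * Cᴴ ≤ C * B * Cᴴ := by
  rw [le_iff] at h ⊢
  have := h.mul_mul_conjTranspose_same C
  rwa [Matrix.mul_sub, Matrix.sub_mul] at this

lemma trace_re_mono {A B : Matrix ι ι ℂ} (h : A ≤ B) : A.trace.re ≤ B.trace.re := by
  have h1 := (le_iff.mp h).trace_nonneg
  rw [trace_sub, sub_nonneg] at h1
  exact (Complex.le_def.mp h1).1

/-- Schur complement with respect to one diagonal block. The variant below uses the other block, and
comparing the two shows that the adjoint of a contraction is a contraction. The block form is also
what the Schur product theorem acts on in `expKernel_contraction`. -/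
lemma fromBlocks_posSemidef_iff (K : Matrix ι ι ℂ) :
    (fromBlocks 1 K Kᴴ 1).PosSemidef ↔ Kᴴ * K ≤ 1 := by
  let _ : Invertible (1 : Matrix ι ι ℂ) := invertibleOne
  rw [PosDef.fromBlocks₁₁ K (1 : Matrix ι ι ℂ) PosDef.one, inv_one, Matrix.mul_one, le_iff]

lemma fromBlocks_posSemidef_iff' (K : Matrix ι ι ℂ) :
    (fromBlocks 1 K Kᴴ 1).PosSemidef ↔ K * Kᴴ ≤ 1 := by
  let _ : Invertible (1 : Matrix ι ι ℂ) := invertibleOne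
  rw [PosDef.fromBlocks₂₂ (1 : Matrix ι ι ℂ) K PosDef.one, inv_one, Matrix.mul_one, le_iff]

lemma conjTranspose_contraction {K : Matrix ι ι ℂ} (h : K * Kᴴ ≤ 1) : Kᴴ * K ≤ 1 :=
  (fromBlocks_posSemidef_iff K).mp ((fromBlocks_posSemidef_iff' K).mpr h)

/-- Douglas factorisation through the square root of a dominating operator. -/
lemma exists_contraction_of_le {A T : Matrix ι ι ℂ} (hT : T.PosSemidef) (h : A * Aᴴ ≤ T) :
    ∃ G : Matrix ι ι ℂ, A = CFC.sqrt T * G ∧ G * Gᴴ ≤ 1 ∧ (A * Aᴴ = T → G * Aᴴ = CFC.sqrt T) := by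
  obtain ⟨V, t, hV, rfl, -⟩ := exists_diagConj hT.1
  have ht := eigenvalues_nonneg_of_diagConj hV hT
  rw [sqrt_diagConj hV ht]
  -- P is the pseudo-inverse of √T (as 0⁻¹ = 0) and Q the projection onto ker T. Since √T P + Q = 1,
  -- the witness G = P A works once Q A = 0, which follows from Q A A* Q ≤ Q T Q = 0.
  set P := diagConj V (fun i => (√(t i))⁻¹) with hP
  set Q := diagConj V (fun i => if t i = 0 then (1 : ℝ) else 0) with hQ
  have hPh : Pᴴ = P := diagConj_isHermitian V _
  have hQh : Qᴴ = Q := diagConj_isHermitian V _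
  have hsplit : diagConj V (fun i => √(t i)) * P + Q = 1 := by
    rw [hP, hQ, diagConj_mul hV, ← diagConj_one hV, ← sub_eq_zero, add_sub_assoc, diagConj_sub,
      ← sub_neg_eq_add, ← neg_one_smul ℝ, diagConj_smul, diagConj_sub]
    have : (fun i => √(t i) * (√(t i))⁻¹ - -1 * ((if t i = 0 then (1 : ℝ) else 0) - 1))
        = fun i => 0 := by
      ext i
      by_cases h0 : t i = 0
      · simp [h0]
      · have : √(t i) ≠ 0 := (Real.sqrt_pos.mpr (lt_of_le_of_ne (ht i) (Ne.symm h0))).ne'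
        simp [h0, this]
    rw [this]
    simp [diagConj]
  have hQT : Q * diagConj V t * Qᴴ = 0 := by
    rw [hQh, hQ, diagConj_mul hV, diagConj_mul hV]
    have : (fun i => (if t i = 0 then (1 : ℝ) else 0) * t i * (if t i = 0 then (1 : ℝ) else 0))
        = fun i => 0 := by
      ext i
      by_cases h0 : t i = 0 <;> simp [h0]
    rw [this]
    simp [diagConj]
  have hQA : Q * A = 0 := by
    have h1 := conj_le_conj h Q
    rw [hQT] at h1
    have h2 : Q * (A * Aᴴ) * Qᴴ = (Q * A) * (Q * A)ᴴ := by
      simp only [conjTranspose_mul, Matrix.mul_assoc]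
    rw [h2] at h1
    have h3 : (Q * A) * (Q * A)ᴴ = 0 :=
      le_antisymm h1 (nonneg_iff_posSemidef.mpr (posSemidef_self_mul_conjTranspose _))
    exact self_mul_conjTranspose_eq_zero.mp h3
  refine ⟨P * A, ?_, ?_, fun hA => ?_⟩
  · rw [← Matrix.mul_assoc]
    calc A = (diagConj V (fun i => √(t i)) * P + Q) * A := by rw [hsplit, Matrix.one_mul]
      _ = _ := by rw [Matrix.add_mul, hQA, add_zero]
  · have h1 : P * A * (P * A)ᴴ = P * (A * Aᴴ) * Pᴴ := by
      simp only [conjTranspose_mul, Matrix.mul_assoc]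
    rw [h1]
    refine (conj_le_conj h P).trans ?_
    rw [hPh, hP, diagConj_mul hV, diagConj_mul hV, ← diagConj_one hV, le_iff, diagConj_sub]
    refine diagConj_posSemidef V fun i => ?_
    by_cases h0 : t i = 0
    · simp [h0]
    · have h1 : √(t i) ≠ 0 := (Real.sqrt_pos.mpr (lt_of_le_of_ne (ht i) (Ne.symm h0))).ne'
      have h2 := Real.mul_self_sqrt (ht i)
      have : (√(t i))⁻¹ * t i * (√(t i))⁻¹ = 1 := by
        rw [← h2, Real.sqrt_mul_self (Real.sqrt_nonneg _)]
        field_simp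
      rw [this, sub_self]
  · rw [Matrix.mul_assoc, hA, hP, diagConj_mul hV]
    congr 1
    ext i
    by_cases h0 : t i = 0
    · simp [h0]
    · have h1 : √(t i) ≠ 0 := (Real.sqrt_pos.mpr (lt_of_le_of_ne (ht i) (Ne.symm h0))).ne'
      rw [inv_mul_eq_div, div_eq_iff h1, Real.mul_self_sqrt (ht i)]

/-- Expanding Tr (1 - C) P (1 - C)* ≥ 0 gives 2 Re Tr C P ≤ Tr P + Tr C* C P, and the last trace is
at most Tr P. -/
lemma trace_contraction_mul_le {C P : Matrix ι ι ℂ} (hC : C * Cᴴ ≤ 1) (hP : P.PosSemidef) :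
    (C * P).trace.re ≤ P.trace.re := by
  have h1 := (hP.mul_mul_conjTranspose_same (1 - C)).trace_nonneg
  have h2 : ((1 - Cᴴ * C) * P).trace.re = (CFC.sqrt P * (1 - Cᴴ * C) * (CFC.sqrt P)ᴴ).trace.re := by
    have hs : (CFC.sqrt P)ᴴ = CFC.sqrt P :=
      (nonneg_iff_posSemidef.mp (CFC.sqrt_nonneg P)).1
    rw [hs, Matrix.mul_assoc, Matrix.trace_mul_comm (CFC.sqrt P), Matrix.mul_assoc,
      CFC.sqrt_mul_sqrt_self P (nonneg_iff_posSemidef.mpr hP)]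
  have h3 : 0 ≤ ((1 - Cᴴ * C) * P).trace.re := by
    rw [h2]
    have h4 := ((le_iff.mp (conjTranspose_contraction hC)).mul_mul_conjTranspose_same
      (CFC.sqrt P)).trace_nonneg
    exact (Complex.le_def.mp h4).1
  have h5 : (P * Cᴴ).trace.re = (C * P).trace.re := by
    have : P * Cᴴ = (C * P)ᴴ := by rw [conjTranspose_mul, hP.1]
    rw [this, trace_conjTranspose]
    simp
  have h6 : (1 - C) * P * (1 - C)ᴴ = P - C * P - P * Cᴴ + C * P * Cᴴ := by
    rw [conjTranspose_sub, conjTranspose_one]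
    noncomm_ring
  have h7 : (C * P * Cᴴ).trace = (Cᴴ * C * P).trace := by
    rw [Matrix.trace_mul_comm, Matrix.mul_assoc]
  rw [h6, trace_add, trace_sub, trace_sub, h7] at h1
  rw [Matrix.sub_mul, Matrix.one_mul, trace_sub, Complex.sub_re] at h3
  have h8 := (Complex.le_def.mp h1).1
  simp only [Complex.add_re, Complex.sub_re, Complex.zero_re, h5] at h8
  linarith

/-! ### Variational bounds on the fidelity -/

lemma sqrt_isHermitian (A : Matrix ι ι ℂ) : (CFC.sqrt A)ᴴ = CFC.sqrt A :=
  (nonneg_iff_posSemidef.mp (CFC.sqrt_nonneg A)).1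

lemma trace_conjTranspose_re (A : Matrix ι ι ℂ) : Aᴴ.trace.re = A.trace.re := by
  rw [trace_conjTranspose]
  simp

lemma sqrt_mul_mul_sqrt_eq {ω ρ : Matrix ι ι ℂ} (hρ : ρ.PosSemidef) :
    (CFC.sqrt ρ * CFC.sqrt ω)ᴴ * ((CFC.sqrt ρ * CFC.sqrt ω)ᴴ)ᴴ
      = CFC.sqrt ω * ρ * CFC.sqrt ω := by
  rw [conjTranspose_conjTranspose, conjTranspose_mul, sqrt_isHermitian, sqrt_isHermitian]
  calc CFC.sqrt ω * CFC.sqrt ρ * (CFC.sqrt ρ * CFC.sqrt ω)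
      = CFC.sqrt ω * (CFC.sqrt ρ * CFC.sqrt ρ) * CFC.sqrt ω := by simp only [Matrix.mul_assoc]
    _ = _ := by rw [CFC.sqrt_mul_sqrt_self ρ (nonneg_iff_posSemidef.mpr hρ)]

/-- Polar decomposition of √ω √ρ, by the equality case of the Douglas factorisation. A contraction
in place of a unitary is enough for the converse. -/
lemma exists_fidelity_eq (ω : Matrix ι ι ℂ) {ρ : Matrix ι ι ℂ} (hρ : ρ.PosSemidef) :
    ∃ K : Matrix ι ι ℂ, K * Kᴴ ≤ 1 ∧
      fidelity ω ρ = (CFC.sqrt ω * K * CFC.sqrt ρ).trace.re := by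
  have h := sqrt_mul_mul_sqrt_eq (ω := ω) hρ
  obtain ⟨K, -, hK, hK2⟩ := exists_contraction_of_le
    (posSemidef_self_mul_conjTranspose (CFC.sqrt ρ * CFC.sqrt ω)ᴴ) le_rfl
  refine ⟨K, hK, ?_⟩
  have h2 := hK2 rfl
  rw [h, conjTranspose_conjTranspose] at h2
  rw [fidelity, ← h2, ← Matrix.mul_assoc, Matrix.trace_mul_comm, Matrix.mul_assoc]

/-- Uhlmann-type lower bound: writing A = √ω G turns the left side into the trace of a contraction
times the positive operator √(√ω ρ √ω). Lower bounds on the fidelity thus need no square root of ω.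
-/
lemma trace_le_fidelity {A ω ρ : Matrix ι ι ℂ} (hω : ω.PosSemidef) (hρ : ρ.PosSemidef)
    (h : A * Aᴴ ≤ ω) : (A * CFC.sqrt ρ).trace.re ≤ fidelity ω ρ := by
  obtain ⟨G, hG, hG1, -⟩ := exists_contraction_of_le hω h
  have hM := sqrt_mul_mul_sqrt_eq (ω := ω) hρ
  set M := CFC.sqrt ρ * CFC.sqrt ω with hMdef
  obtain ⟨K, hK, hK1, -⟩ := exists_contraction_of_le
    (posSemidef_self_mul_conjTranspose Mᴴ) le_rfl
  rw [hM] at hK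
  set P := CFC.sqrt (CFC.sqrt ω * ρ * CFC.sqrt ω)
  have hP : P.PosSemidef := nonneg_iff_posSemidef.mp (CFC.sqrt_nonneg _)
  have h1 : (A * CFC.sqrt ρ).trace.re = (K * Gᴴ * P).trace.re := by
    rw [← trace_conjTranspose_re (A * CFC.sqrt ρ)]
    have : ((A * CFC.sqrt ρ)ᴴ).trace = (K * Gᴴ * P).trace := by
      rw [conjTranspose_mul, sqrt_isHermitian, hG, conjTranspose_mul, sqrt_isHermitian,
        Matrix.trace_mul_comm, Matrix.mul_assoc]
      have h2 : CFC.sqrt ω * CFC.sqrt ρ = Mᴴ := by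
        rw [hMdef, conjTranspose_mul, sqrt_isHermitian, sqrt_isHermitian]
      rw [h2, hK, ← Matrix.mul_assoc, Matrix.trace_mul_comm, Matrix.mul_assoc]
    rw [this]
  rw [h1, fidelity]
  refine trace_contraction_mul_le ?_ hP
  have h3 : K * Gᴴ * (K * Gᴴ)ᴴ = K * (Gᴴ * G) * Kᴴ := by
    simp only [conjTranspose_mul, conjTranspose_conjTranspose, Matrix.mul_assoc]
  rw [h3]
  refine (conj_le_conj (conjTranspose_contraction hG1) K).trans ?_
  rwa [Matrix.mul_one]

/-! ### Schur multipliers -/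

/-- This is the Gram matrix in L² of the indicator functions of the intervals [0, c i). The complex
quadratic form splits into the real forms at the real and imaginary parts of the vector. -/
lemma posSemidef_min {κ : Type*} [Fintype κ] {c : κ → ℝ} (hc : ∀ i, 0 ≤ c i) :
    (Matrix.of fun i j => ((min (c i) (c j) : ℝ) : ℂ)).PosSemidef := by
  have h := MeasureTheory.posSemidef_matrix_measure_inter
    (μ := MeasureTheory.volume) (s := fun i => Set.Ico (0 : ℝ) (c i))
    (fun i => measurableSet_Ico) (fun i => by simp)
  have h1 : (Matrix.of fun i j : κ =>
      MeasureTheory.volume.real (Set.Ico (0 : ℝ) (c i) ∩ Set.Ico (0 : ℝ) (c j)))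
      = Matrix.of fun i j => min (c i) (c j) := by
    ext i j
    simp only [of_apply, Set.Ico_inter_Ico, max_self]
    rw [Real.volume_real_Ico, sub_zero, max_eq_left (le_min (hc i) (hc j))]
  rw [h1] at h
  refine PosSemidef.of_dotProduct_mulVec_nonneg ?_ fun x => ?_
  · ext i j
    simp [min_comm]
  · have hre := h.dotProduct_mulVec_nonneg (fun i => (x i).re)
    have him := h.dotProduct_mulVec_nonneg (fun i => (x i).im)
    have key : star x ⬝ᵥ ((Matrix.of fun i j => ((min (c i) (c j) : ℝ) : ℂ)) *ᵥ x)
        = ((∑ i, ∑ j, min (c i) (c j) * ((x i).re * (x j).re + (x i).im * (x j).im) : ℝ) : ℂ) := by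
      have e1 : star x ⬝ᵥ ((Matrix.of fun i j => ((min (c i) (c j) : ℝ) : ℂ)) *ᵥ x)
          = ∑ i, ∑ j, ((min (c i) (c j) : ℝ) : ℂ) * (star (x i) * x j) := by
        simp only [dotProduct, mulVec, of_apply, Pi.star_apply, Finset.mul_sum]
        exact Finset.sum_congr rfl fun i _ => Finset.sum_congr rfl fun j _ => by ring
      rw [e1]
      apply Complex.ext
      · simp only [Complex.re_sum, Complex.re_ofReal_mul, Complex.ofReal_re]
        refine Finset.sum_congr rfl fun i _ => Finset.sum_congr rfl fun j _ => ?_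
        simp
      · simp only [Complex.im_sum, Complex.im_ofReal_mul, Complex.ofReal_im]
        have : ∀ i j, min (c i) (c j) * (star (x i) * x j).im
            = min (c i) (c j) * ((x i).re * (x j).im) - min (c i) (c j) * ((x i).im * (x j).re) := by
          intro i j
          simp
          ring
        simp only [this, Finset.sum_sub_distrib]
        rw [sub_eq_zero, Finset.sum_comm]
        refine Finset.sum_congr rfl fun i _ => Finset.sum_congr rfl fun j _ => ?_
        rw [min_comm]
        ring
    rw [key]
    norm_cast
    simp only [dotProduct, mulVec, of_apply, Finset.mul_sum, star_trivial] at hre him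
    have : ∑ i, ∑ j, min (c i) (c j) * ((x i).re * (x j).re + (x i).im * (x j).im)
        = (∑ i, ∑ j, (x i).re * (min (c i) (c j) * (x j).re))
          + ∑ i, ∑ j, (x i).im * (min (c i) (c j) * (x j).im) := by
      simp only [← Finset.sum_add_distrib]
      exact Finset.sum_congr rfl fun i _ => Finset.sum_congr rfl fun j _ => by ring
    rw [this]
    exact add_nonneg hre him

/-- The kernel `min (a, b) / √(a b)`, which is `exp (-|x - y| / 2)` for `a = exp x`, `b = exp y`. -/
def expKernel (a b : ℝ) : ℝ := (√a)⁻¹ * min a b * (√b)⁻¹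

lemma expKernel_self {a : ℝ} (ha : 0 < a) : expKernel a a = 1 := by
  have h : √a ≠ 0 := (Real.sqrt_pos.mpr ha).ne'
  have h2 := Real.mul_self_sqrt ha.le
  rw [expKernel, min_self]
  field_simp
  nlinarith

lemma expKernel_zero : expKernel 0 0 = 0 := by simp [expKernel]

lemma posSemidef_expKernel {κ : Type*} [Fintype κ] [DecidableEq κ] {c : κ → ℝ}
    (hc : ∀ i, 0 ≤ c i) : (Matrix.of fun i j => ((expKernel (c i) (c j) : ℝ) : ℂ)).PosSemidef := by
  have h := (posSemidef_min hc).mul_mul_conjTranspose_same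
    (diagonal fun i => (((√(c i))⁻¹ : ℝ) : ℂ))
  convert! h using 1
  ext i j
  rw [diagonal_conjTranspose, Matrix.mul_diagonal, Matrix.diagonal_mul]
  simp [expKernel]

/-- Entrywise multiplication of a unitary by `expKernel` gives a contraction. -/
lemma expKernel_contraction {U : Matrix ι ι ℂ} (hU : Uᴴ * U = 1) {a b : ι → ℝ}
    (ha : ∀ i, 0 ≤ a i) (hb : ∀ i, 0 ≤ b i) :
    (Matrix.of fun i j => (expKernel (a i) (b j) : ℂ) * U i j)ᴴ
      * (Matrix.of fun i j => (expKernel (a i) (b j) : ℂ) * U i j) ≤ 1 := by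
  set C : Matrix ι ι ℂ := Matrix.of fun i j => (expKernel (a i) (b j) : ℂ) * U i j with hC
  have hK := posSemidef_expKernel (c := Sum.elim a b) (by
    rintro (i | i)
    · exact ha i
    · exact hb i)
  have hB : (fromBlocks 1 U Uᴴ 1).PosSemidef := (fromBlocks_posSemidef_iff U).mpr hU.le
  have hH := hK.hadamard hB
  -- Where a weight is zero the kernel vanishes on the diagonal instead of being 1, because (√0)⁻¹ =
  -- 0. This nonnegative diagonal matrix restores the identity blocks after the Schur product.
  have hD : (diagonal fun p : ι ⊕ ι =>
      ((1 - expKernel (Sum.elim a b p) (Sum.elim a b p) : ℝ) : ℂ)).PosSemidef := by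
    refine PosSemidef.diagonal fun p => ?_
    have h0 : 0 ≤ Sum.elim a b p := by
      rcases p with i | i
      · exact ha i
      · exact hb i
    rcases h0.eq_or_lt with h | h
    · simp [← h, expKernel_zero]
    · simp [expKernel_self h]
  have hS := hH.add hD
  have : fromBlocks 1 C Cᴴ 1 = (Matrix.of fun i j : ι ⊕ ι =>
      ((expKernel (Sum.elim a b i) (Sum.elim a b j) : ℝ) : ℂ)) ⊙ fromBlocks 1 U Uᴴ 1
      + (diagonal fun p : ι ⊕ ι =>
        ((1 - expKernel (Sum.elim a b p) (Sum.elim a b p) : ℝ) : ℂ)) := by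
    ext p q
    rcases p with i | i <;> rcases q with j | j
    · by_cases hij : i = j
      · subst hij; simp
      · simp [hij]
    · simp [hC]
    · have : expKernel (a j) (b i) = expKernel (b i) (a j) := by
        simp only [expKernel, min_comm]; ring
      simp [hC, this]
    · by_cases hij : i = j
      · subst hij; simp
      · simp [hij]
  rw [← this] at hS
  exact (fromBlocks_posSemidef_iff C).mp hS

/-! ### One-shot bounds -/

lemma trace_diagConj_mul_mul (V V' G : Matrix ι ι ℂ) (f g : ι → ℝ) :
    (diagConj V' f * G * diagConj V g).trace
      = ∑ j, ∑ i, (f j : ℂ) * (V'ᴴ * G * V) j i * (g i : ℂ) * (Vᴴ * V') i j := by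
  have h1 : (diagConj V' f * G * diagConj V g).trace
      = (diagonal (fun i => (f i : ℂ)) * (V'ᴴ * G * V) * diagonal (fun i => (g i : ℂ))
          * (Vᴴ * V')).trace := by
    have e1 : diagConj V' f * G * diagConj V g = V' * (diagonal (fun i => (f i : ℂ)) *
        (V'ᴴ * G * V) * diagonal (fun i => (g i : ℂ)) * Vᴴ) := by
      simp only [diagConj, Matrix.mul_assoc]
    rw [e1, Matrix.trace_mul_comm]
    simp only [Matrix.mul_assoc]
  rw [h1, Matrix.trace]
  refine Finset.sum_congr rfl fun j _ => ?_
  rw [Matrix.diag_apply, Matrix.mul_apply]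
  refine Finset.sum_congr rfl fun i _ => ?_
  rw [Matrix.mul_diagonal, Matrix.diagonal_mul]

lemma trace_mul_conjTranspose_re (A : Matrix ι ι ℂ) :
    (A * Aᴴ).trace.re = ∑ j, ∑ i, Complex.normSq (A j i) := by
  rw [Matrix.trace, Complex.re_sum]
  refine Finset.sum_congr rfl fun j _ => ?_
  rw [Matrix.diag_apply, Matrix.mul_apply, Complex.re_sum]
  refine Finset.sum_congr rfl fun i _ => ?_
  rw [conjTranspose_apply, Complex.star_def, Complex.mul_conj, Complex.ofReal_re]

lemma trace_diagConj_mul_self {V V' : Matrix ι ι ℂ} (hV : Vᴴ * V = 1) (hV' : V'ᴴ * V' = 1)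
    (G : Matrix ι ι ℂ) (f : ι → ℝ) :
    ((diagConj V' f * G) * (diagConj V' f * G)ᴴ).trace.re
      = ∑ j, ∑ i, f j ^ 2 * Complex.normSq ((V'ᴴ * G * V) j i) := by
  have h1 : ((diagConj V' f * G) * (diagConj V' f * G)ᴴ).trace
      = ((diagonal (fun i => (f i : ℂ)) * (V'ᴴ * G * V))
        * (diagonal (fun i => (f i : ℂ)) * (V'ᴴ * G * V))ᴴ).trace := by
    have e1 : diagConj V' f * G
        = V' * (diagonal (fun i => (f i : ℂ)) * (V'ᴴ * G * V)) * Vᴴ := by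
      have : V * Vᴴ = 1 := mul_eq_one_comm.mp hV
      simp only [diagConj, Matrix.mul_assoc, this, Matrix.mul_one]
    set Y := diagonal (fun i => (f i : ℂ)) * (V'ᴴ * G * V)
    have e2 : V' * Y * Vᴴ * (V' * Y * Vᴴ)ᴴ = V' * (Y * (Vᴴ * V) * Yᴴ * V'ᴴ) := by
      simp only [conjTranspose_mul, conjTranspose_conjTranspose, Matrix.mul_assoc]
    rw [e1, e2, hV, Matrix.mul_one, Matrix.trace_mul_comm, Matrix.mul_assoc, hV', Matrix.mul_one]
  rw [h1, trace_mul_conjTranspose_re]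
  refine Finset.sum_congr rfl fun j _ => Finset.sum_congr rfl fun i _ => ?_
  rw [Matrix.diagonal_mul, Complex.normSq_mul, Complex.normSq_ofReal, sq]

lemma IsState.trace_re {ρ : Matrix ι ι ℂ} (h : IsState ρ) : ρ.trace.re = 1 := by
  rw [h.2, Complex.one_re]

lemma trace_smul_re (c : ℝ) (A : Matrix ι ι ℂ) : (c • A).trace.re = c * A.trace.re := by
  rw [trace_smul]
  simp

lemma trace_eq_re {A : Matrix ι ι ℂ} (hA : A.PosSemidef) : A.trace = (A.trace.re : ℂ) := by
  have := (Complex.le_def.mp hA.trace_nonneg).2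
  apply Complex.ext
  · simp
  · simpa using this.symm

lemma smul_le_smul_of_le {A : Matrix ι ι ℂ} {c c' : ℝ} (hA : A.PosSemidef) (h : c ≤ c') :
    c • A ≤ c' • A := by
  rw [le_iff, ← sub_smul]
  exact hA.smul (sub_nonneg.mpr h)

/-- A subnormalised operator below `lam • σ` extends or rescales to a state below `lam • σ`. -/
lemma exists_state_of_le {A σ ρ : Matrix ι ι ℂ} {lam : ℝ} (hlam : 1 ≤ lam) (hσ : IsState σ)
    (hρ : ρ.PosSemidef) (h : A * Aᴴ ≤ lam • σ) :
    ∃ ω, IsState ω ∧ ω ≤ lam • σ ∧ ((A * CFC.sqrt ρ).trace.re ≤ fidelity ω ρ ∨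
      (A * CFC.sqrt ρ).trace.re ≤ √((A * Aᴴ).trace.re) * fidelity ω ρ) := by
  have hA : (A * Aᴴ).PosSemidef := posSemidef_self_mul_conjTranspose A
  set T := (A * Aᴴ).trace.re with hT
  rcases lt_or_ge T 1 with h1 | h1
  · have hlT : 0 < lam - T := by linarith
    -- The solution of T + c (lam - T) = 1: moving from A A* towards lam σ until the trace is one
    -- keeps the operator between A A* and lam σ.
    set c := (1 - T) / (lam - T) with hc
    have hc0 : 0 ≤ c := div_nonneg (by linarith) hlT.le
    have hc1 : c ≤ 1 := by rw [hc, div_le_one hlT]; linarith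
    have hge : A * Aᴴ ≤ A * Aᴴ + c • (lam • σ - A * Aᴴ) := by
      rw [le_iff, add_sub_cancel_left]
      exact (le_iff.mp h).smul hc0
    have hps : (A * Aᴴ + c • (lam • σ - A * Aᴴ)).PosSemidef :=
      hA.add ((le_iff.mp h).smul hc0)
    refine ⟨A * Aᴴ + c • (lam • σ - A * Aᴴ), ⟨hps, ?_⟩, ?_, Or.inl ?_⟩
    · rw [trace_eq_re hps, trace_add, Complex.add_re, trace_smul_re, trace_sub, Complex.sub_re,
        trace_smul_re, hσ.trace_re, ← hT, hc, mul_one, div_mul_cancel₀ _ hlT.ne']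
      simp
    · have := smul_le_smul_of_le (le_iff.mp h) hc1
      rw [one_smul] at this
      calc A * Aᴴ + c • (lam • σ - A * Aᴴ) ≤ A * Aᴴ + (lam • σ - A * Aᴴ) :=
            add_le_add_right this _
        _ = lam • σ := by abel
    · exact trace_le_fidelity hps hρ hge
  · have hT0 : 0 < T := by linarith
    have hps : (T⁻¹ • (A * Aᴴ)).PosSemidef := hA.smul (inv_nonneg.mpr hT0.le)
    refine ⟨T⁻¹ • (A * Aᴴ), ⟨hps, ?_⟩, ?_, Or.inr ?_⟩
    · rw [trace_eq_re hps, trace_smul_re, ← hT, inv_mul_cancel₀ hT0.ne']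
      simp
    · refine le_trans ?_ h
      have := smul_le_smul_of_le hA (inv_le_one_of_one_le₀ h1)
      rwa [one_smul] at this
    · have h2 : ((√T)⁻¹ • A) * ((√T)⁻¹ • A)ᴴ ≤ T⁻¹ • (A * Aᴴ) := by
        rw [conjTranspose_smul, Matrix.smul_mul, Matrix.mul_smul, smul_smul, star_trivial,
          ← mul_inv, Real.mul_self_sqrt hT0.le]
      have h3 := trace_le_fidelity hps hρ h2
      rw [Matrix.smul_mul, trace_smul_re, inv_mul_le_iff₀ (Real.sqrt_pos.mpr hT0)] at h3
      exact h3

/-- The reason for the choice of kernel: its denominators cancel against √r and √(μ s), leaving the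
classical min(r, μ s) in the overlap Tr A √ρ. -/
lemma sqrt_mul_expKernel_mul {r s lam μ : ℝ} (hr : 0 ≤ r) (hs : 0 ≤ s) (hμ : 0 < μ) :
    √(lam * s) * expKernel r (μ * s) * √r = √(lam / μ) * min r (μ * s) := by
  rcases hr.eq_or_lt with rfl | hr
  · simp [min_eq_left (mul_nonneg hμ.le hs)]
  rcases hs.eq_or_lt with rfl | hs
  · simp [min_eq_right hr.le]
  have h1 : √r ≠ 0 := (Real.sqrt_pos.mpr hr).ne'
  have h2 : √(μ * s) ≠ 0 := (Real.sqrt_pos.mpr (mul_pos hμ hs)).ne'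
  have h3 : √(lam * s) = √(lam / μ) * √(μ * s) := by
    rw [← Real.sqrt_mul' _ (mul_pos hμ hs).le]
    congr 1
    field_simp
  rw [expKernel, h3]
  field_simp

/-- For positive r and s the left side is (lam/μ) min²/r, and min ≤ r. It bounds Tr A A*, the price
of normalisation. -/
lemma sq_sqrt_mul_sq_expKernel_le {r s lam μ : ℝ} (hr : 0 ≤ r) (hs : 0 ≤ s) (hμ : 0 < μ)
    (hlam : 0 ≤ lam) :
    √(lam * s) ^ 2 * expKernel r (μ * s) ^ 2 ≤ lam / μ * min r (μ * s) := by
  have h0 : 0 ≤ lam / μ * min r (μ * s) :=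
    mul_nonneg (div_nonneg hlam hμ.le) (le_min hr (mul_nonneg hμ.le hs))
  rcases hr.eq_or_lt with rfl | hr
  · refine le_trans (le_of_eq ?_) h0
    simp [expKernel]
  rcases hs.eq_or_lt with rfl | hs
  · refine le_trans (le_of_eq ?_) h0
    simp
  have h1 : (√r)⁻¹ ^ 2 = r⁻¹ := by rw [inv_pow, Real.sq_sqrt hr.le]
  have h2 : (√(μ * s))⁻¹ ^ 2 = (μ * s)⁻¹ := by rw [inv_pow, Real.sq_sqrt (mul_pos hμ hs).le]
  have h3 : √(lam * s) ^ 2 * expKernel r (μ * s) ^ 2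
      = lam / μ * min r (μ * s) * (min r (μ * s) / r) := by
    rw [Real.sq_sqrt (mul_nonneg hlam hs.le), expKernel, mul_pow, mul_pow, h1, h2]
    field_simp
  rw [h3]
  refine mul_le_of_le_one_right h0 ?_
  rw [div_le_one hr]
  exact min_le_left _ _

/-- Achievability: a state below `lam • σ` with a large fidelity with `ρ`, in terms of the joint
distribution `r i * |U i j| ^ 2` of the two eigenbases. -/
lemma exists_state_fidelity {V V' : Matrix ι ι ℂ} (hV : Vᴴ * V = 1) (hV' : V'ᴴ * V' = 1)
    {r s : ι → ℝ} (hr : ∀ i, 0 ≤ r i) (hs : ∀ i, 0 ≤ s i) (hσ : IsState (diagConj V' s))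
    {lam μ m : ℝ} (hlam : 1 ≤ lam) (hμ : 0 < μ)
    (hm : m = ∑ i, ∑ j, min (r i) (μ * s j) * Complex.normSq ((Vᴴ * V') i j)) (hm0 : 0 < m) :
    ∃ ω, IsState ω ∧ ω ≤ lam • diagConj V' s ∧
      (√(lam / μ) * m ≤ fidelity ω (diagConj V r) ∨ √m ≤ fidelity ω (diagConj V r)) := by
  set U := Vᴴ * V' with hU
  have hUU : Uᴴ * U = 1 := by
    have : V * Vᴴ = 1 := mul_eq_one_comm.mp hV
    rw [hU, conjTranspose_mul, conjTranspose_conjTranspose, Matrix.mul_assoc,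
      ← Matrix.mul_assoc V, this, Matrix.one_mul, hV']
  set C : Matrix ι ι ℂ := Matrix.of fun i j => (expKernel (r i) (μ * s j) : ℂ) * U i j with hC
  have hCC : Cᴴ * C ≤ 1 := expKernel_contraction hUU hr fun j => mul_nonneg hμ.le (hs j)
  set G := V' * Cᴴ * Vᴴ with hG
  have hGC : V'ᴴ * G * V = Cᴴ := by
    have : V'ᴴ * G * V = (V'ᴴ * V') * Cᴴ * (Vᴴ * V) := by simp only [hG, Matrix.mul_assoc]
    rw [this, hV, hV', Matrix.one_mul, Matrix.mul_one]
  have hGG : G * Gᴴ ≤ 1 := by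
    have : G * Gᴴ = V' * (Cᴴ * (Vᴴ * V) * C) * V'ᴴ := by
      simp only [hG, conjTranspose_mul, conjTranspose_conjTranspose, Matrix.mul_assoc]
    rw [this, hV, Matrix.mul_one]
    refine (conj_le_conj hCC V').trans (le_of_eq ?_)
    rw [Matrix.mul_one, mul_eq_one_comm.mp hV']
  have hlam0 : 0 ≤ lam := by linarith
  have hls : ∀ j, 0 ≤ lam * s j := fun j => mul_nonneg hlam0 (hs j)
  set A := diagConj V' (fun j => √(lam * s j)) * G with hA
  have hAA : A * Aᴴ ≤ lam • diagConj V' s := by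
    have : A * Aᴴ = diagConj V' (fun j => √(lam * s j)) * (G * Gᴴ)
        * (diagConj V' (fun j => √(lam * s j)))ᴴ := by
      simp only [hA, conjTranspose_mul, Matrix.mul_assoc]
    rw [this]
    refine (conj_le_conj hGG _).trans (le_of_eq ?_)
    rw [Matrix.mul_one, diagConj_isHermitian, diagConj_mul hV', diagConj_smul]
    congr 1
    ext j
    exact Real.mul_self_sqrt (hls j)
  have htr : (A * CFC.sqrt (diagConj V r)).trace.re = √(lam / μ) * m := by
    rw [sqrt_diagConj hV hr, hA, trace_diagConj_mul_mul, hGC, Finset.sum_comm, hm,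
      Finset.mul_sum, Complex.re_sum]
    refine Finset.sum_congr rfl fun i _ => ?_
    rw [Finset.mul_sum, Complex.re_sum]
    refine Finset.sum_congr rfl fun j _ => ?_
    rw [← mul_assoc, ← sqrt_mul_expKernel_mul (hr i) (hs j) hμ, conjTranspose_apply, hC, of_apply]
    have := Complex.mul_conj (U i j)
    have e : (√(lam * s j) : ℂ) * star ((expKernel (r i) (μ * s j) : ℂ) * U i j) * (√(r i) : ℂ)
        * U i j = ((√(lam * s j) * expKernel (r i) (μ * s j) * √(r i)
          * Complex.normSq (U i j) : ℝ) : ℂ) := by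
      push_cast
      rw [← this]
      simp only [Complex.star_def, map_mul, Complex.conj_ofReal]
      ring
    rw [e, Complex.ofReal_re]
  have hT : (A * Aᴴ).trace.re ≤ lam / μ * m := by
    rw [hA, trace_diagConj_mul_self hV hV', hGC, Finset.sum_comm, hm, Finset.mul_sum]
    refine Finset.sum_le_sum fun i _ => ?_
    rw [Finset.mul_sum]
    refine Finset.sum_le_sum fun j _ => ?_
    rw [conjTranspose_apply, hC, of_apply, Complex.star_def, Complex.normSq_conj,
      Complex.normSq_mul, Complex.normSq_ofReal, ← sq, ← mul_assoc, ← mul_assoc]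
    exact mul_le_mul_of_nonneg_right
      (sq_sqrt_mul_sq_expKernel_le (hr i) (hs j) hμ hlam0) (Complex.normSq_nonneg _)
  obtain ⟨ω, h1, h2, h3⟩ := exists_state_of_le hlam hσ (diagConj_posSemidef V hr) hAA
  refine ⟨ω, h1, h2, ?_⟩
  rw [htr] at h3
  rcases h3 with h3 | h3
  · exact Or.inl h3
  · refine Or.inr ?_
    -- After rescaling, √(lam/μ) m ≤ √(Tr A A*) F ≤ √((lam/μ) m) F, so the factor lam/μ cancels and
    -- F ≥ √m.
    have hlm : 0 < lam / μ := div_pos (by linarith) hμ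
    have hF : 0 ≤ fidelity ω (diagConj V r) := by
      have := (nonneg_iff_posSemidef.mp (CFC.sqrt_nonneg
        (CFC.sqrt ω * diagConj V r * CFC.sqrt ω))).trace_nonneg
      exact (Complex.le_def.mp this).1
    have h4 := h3.trans (mul_le_mul_of_nonneg_right (Real.sqrt_le_sqrt hT) hF)
    rw [Real.sqrt_mul hlm.le, mul_assoc,
      mul_le_mul_iff_right₀ (Real.sqrt_pos.mpr hlm)] at h4
    nth_rewrite 1 [← Real.mul_self_sqrt hm0.le] at h4
    exact le_of_mul_le_mul_left h4 (Real.sqrt_pos.mpr hm0)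

/-- Converse: the fidelity with `ρ` of a state below `μ • σ` is bounded as if the event `S`, on
which `lam * s j ≤ r i`, could be measured. -/
lemma fidelity_le_of_le {V V' : Matrix ι ι ℂ} (hV : Vᴴ * V = 1) (hV' : V'ᴴ * V' = 1)
    {r s : ι → ℝ} (hr : ∀ i, 0 ≤ r i) (hs : ∀ i, 0 ≤ s i) (hr1 : ∑ i, r i = 1)
    {ω : Matrix ι ι ℂ} (hω : IsState ω) {lam μ : ℝ} (hμ : 0 ≤ μ)
    (hle : ω ≤ μ • diagConj V' s) (S : Finset (ι × ι))
    (hS : ∀ p ∈ S, lam * s p.2 ≤ r p.1) :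
    ∃ a : ℝ, 0 ≤ a ∧ a ≤ 1 ∧ lam * a ≤ μ ∧
      fidelity ω (diagConj V r) ≤
        √a * √(∑ p ∈ S, r p.1 * Complex.normSq ((Vᴴ * V') p.1 p.2))
        + √(1 - a) * √(1 - ∑ p ∈ S, r p.1 * Complex.normSq ((Vᴴ * V') p.1 p.2)) := by
  set U := Vᴴ * V' with hU
  have hUU : U * Uᴴ = 1 := by
    have : V' * V'ᴴ = 1 := mul_eq_one_comm.mp hV'
    rw [hU, conjTranspose_mul, conjTranspose_conjTranspose, Matrix.mul_assoc,
      ← Matrix.mul_assoc V', this, Matrix.one_mul, hV]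
  have hrow : ∀ i, ∑ j, Complex.normSq (U i j) = 1 := fun i => by
    have h1 : (U * Uᴴ) i i = 1 := by rw [hUU, one_apply_eq]
    rw [Matrix.mul_apply] at h1
    have h2 : ((∑ j, Complex.normSq (U i j) : ℝ) : ℂ) = 1 := by
      rw [← h1]
      push_cast
      exact Finset.sum_congr rfl fun j _ => by
        rw [conjTranspose_apply, Complex.star_def, Complex.mul_conj]
    exact_mod_cast h2
  obtain ⟨K, hK, hF⟩ := exists_fidelity_eq ω (diagConj_posSemidef V hr)
  have hω0 : (0 : Matrix ι ι ℂ) ≤ ω := nonneg_iff_posSemidef.mpr hω.1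
  have hAω : (CFC.sqrt ω * K) * (CFC.sqrt ω * K)ᴴ ≤ ω := by
    have : (CFC.sqrt ω * K) * (CFC.sqrt ω * K)ᴴ = CFC.sqrt ω * (K * Kᴴ) * (CFC.sqrt ω)ᴴ := by
      simp only [conjTranspose_mul, Matrix.mul_assoc]
    rw [this]
    refine (conj_le_conj hK _).trans (le_of_eq ?_)
    rw [Matrix.mul_one, sqrt_isHermitian, CFC.sqrt_mul_sqrt_self ω hω0]
  have hms : ∀ j, 0 ≤ μ * s j := fun j => mul_nonneg hμ (hs j)
  rw [diagConj_smul] at hle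
  obtain ⟨G, hAG, hG, -⟩ :=
    exists_contraction_of_le (diagConj_posSemidef V' hms) (hAω.trans hle)
  rw [sqrt_diagConj hV' hms] at hAG
  set Y := V'ᴴ * G * V with hY
  have hYY : Yᴴ * Y ≤ 1 := by
    have h1 : Yᴴ * Y = Vᴴ * (Gᴴ * (V' * V'ᴴ) * G) * Vᴴᴴ := by
      simp only [hY, conjTranspose_mul, conjTranspose_conjTranspose, Matrix.mul_assoc]
    rw [h1, mul_eq_one_comm.mp hV', Matrix.mul_one]
    refine (conj_le_conj (conjTranspose_contraction hG) _).trans (le_of_eq ?_)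
    rw [Matrix.mul_one, conjTranspose_conjTranspose, hV]
  have hcol : ∀ i, ∑ j, Complex.normSq (Y j i) ≤ 1 := fun i => by
    have h1 := (le_iff.mp hYY).diag_nonneg (i := i)
    rw [Matrix.sub_apply, one_apply_eq, Matrix.mul_apply] at h1
    have h2 : ∑ j, Yᴴ i j * Y j i = ((∑ j, Complex.normSq (Y j i) : ℝ) : ℂ) := by
      push_cast
      exact Finset.sum_congr rfl fun j _ => by
        rw [conjTranspose_apply, Complex.star_def, mul_comm, Complex.mul_conj]
    rw [h2] at h1
    have h3 : (0 : ℂ) ≤ ((1 - ∑ j, Complex.normSq (Y j i) : ℝ) : ℂ) := by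
      push_cast at h1 ⊢
      exact h1
    have := (Complex.le_def.mp h3).1
    rw [Complex.zero_re, Complex.ofReal_re] at this
    linarith
  -- The classical counterpart of ω on the pairs on which P lives: √ω K = √(μσ) G has squared
  -- entries Ω in the two eigenbases, hence Σ Ω ≤ Tr ω = 1. The witness a is the Ω-mass of S;
  -- splitting Σ √Ω √P over S and its complement, Cauchy–Schwarz gives the two terms.
  set Ω : ι × ι → ℝ := fun p => μ * s p.2 * Complex.normSq (Y p.2 p.1) with hΩ
  set P : ι × ι → ℝ := fun p => r p.1 * Complex.normSq (U p.1 p.2) with hP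
  have hΩ0 : ∀ p, 0 ≤ Ω p := fun p => mul_nonneg (hms _) (Complex.normSq_nonneg _)
  have hP0 : ∀ p, 0 ≤ P p := fun p => mul_nonneg (hr _) (Complex.normSq_nonneg _)
  have hΩ1 : ∑ p, Ω p ≤ 1 := by
    have h1 := trace_re_mono hAω
    rw [hω.trace_re, hAG, trace_diagConj_mul_self hV hV', Finset.sum_comm] at h1
    rw [Fintype.sum_prod_type]
    refine le_trans (le_of_eq ?_) h1
    refine Finset.sum_congr rfl fun i _ => Finset.sum_congr rfl fun j _ => ?_
    rw [Real.sq_sqrt (hms j)]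
  have hP1 : ∑ p, P p = 1 := by
    rw [Fintype.sum_prod_type, ← hr1]
    refine Finset.sum_congr rfl fun i _ => ?_
    simp only [hP]
    rw [← Finset.mul_sum, hrow, mul_one]
  have hFle : fidelity ω (diagConj V r) ≤ ∑ p, √(Ω p) * √(P p) := by
    rw [hF, hAG, sqrt_diagConj hV hr, trace_diagConj_mul_mul, Finset.sum_comm,
      Fintype.sum_prod_type, Complex.re_sum]
    refine Finset.sum_le_sum fun i _ => ?_
    rw [Complex.re_sum]
    refine Finset.sum_le_sum fun j _ => (Complex.re_le_norm _).trans (le_of_eq ?_)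
    have e1 : ∀ z : ℂ, √(Complex.normSq z) = ‖z‖ := fun z => by
      rw [Complex.normSq_eq_norm_sq, Real.sqrt_sq (norm_nonneg _)]
    simp only [hΩ, hP, norm_mul, Complex.norm_real, Real.norm_eq_abs,
      abs_of_nonneg (Real.sqrt_nonneg _), Real.sqrt_mul (hms j), Real.sqrt_mul (hr i), e1]
    ring
  have hsplitP : ∑ p ∈ Sᶜ, P p = 1 - ∑ p ∈ S, P p := by
    rw [← hP1, ← Finset.sum_add_sum_compl S]; ring
  have hsplitΩ : ∑ p ∈ Sᶜ, Ω p ≤ 1 - ∑ p ∈ S, Ω p := by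
    have := Finset.sum_add_sum_compl S Ω
    linarith
  refine ⟨∑ p ∈ S, Ω p, Finset.sum_nonneg fun p _ => hΩ0 p, ?_, ?_, ?_⟩
  · have : 0 ≤ ∑ p ∈ Sᶜ, Ω p := Finset.sum_nonneg fun p _ => hΩ0 p
    linarith
  · calc lam * ∑ p ∈ S, Ω p = ∑ p ∈ S, lam * Ω p := Finset.mul_sum _ _ _
      _ ≤ ∑ p ∈ S, μ * (r p.1 * Complex.normSq (Y p.2 p.1)) := by
          refine Finset.sum_le_sum fun p hp => ?_
          have h1 : lam * Ω p = μ * ((lam * s p.2) * Complex.normSq (Y p.2 p.1)) := by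
            simp only [hΩ]; ring
          rw [h1]
          exact mul_le_mul_of_nonneg_left
            (mul_le_mul_of_nonneg_right (hS p hp) (Complex.normSq_nonneg _)) hμ
      _ ≤ ∑ p : ι × ι, μ * (r p.1 * Complex.normSq (Y p.2 p.1)) :=
          Finset.sum_le_univ_sum_of_nonneg fun p =>
            mul_nonneg hμ (mul_nonneg (hr _) (Complex.normSq_nonneg _))
      _ = μ * ∑ i, r i * ∑ j, Complex.normSq (Y j i) := by
          rw [Fintype.sum_prod_type, Finset.mul_sum]
          simp only [Finset.mul_sum]
      _ ≤ μ * ∑ i, r i := by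
          refine mul_le_mul_of_nonneg_left (Finset.sum_le_sum fun i _ => ?_) hμ
          exact mul_le_of_le_one_right (hr i) (hcol i)
      _ = μ := by rw [hr1, mul_one]
  · refine hFle.trans ?_
    rw [← Finset.sum_add_sum_compl S]
    refine add_le_add (Real.sum_sqrt_mul_sqrt_le S hΩ0 hP0) ?_
    rw [← hsplitP]
    refine (Real.sum_sqrt_mul_sqrt_le Sᶜ hΩ0 hP0).trans ?_
    exact mul_le_mul_of_nonneg_right (Real.sqrt_le_sqrt hsplitΩ) (Real.sqrt_nonneg _)

/-! ### Deviations of a centred random variable -/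

section Deviation

variable {κ : Type*} [Fintype κ]

/-- A centred random variable `w` with distribution `p` on a finite set, with exponential moments
and a variance on the scale `N`. -/
structure SubExp (p w : κ → ℝ) (N : ℝ) : Prop where
  nonneg : ∀ i, 0 ≤ p i
  sum_eq_one : ∑ i, p i = 1
  mean : ∑ i, p i * w i = 0
  mgf : ∑ i, p i * Real.exp (w i / (4 * N)) ≤ Real.exp (9 / 32)
  mgf_neg : ∑ i, p i * Real.exp (-w i / (4 * N)) ≤ Real.exp (9 / 32)
  var : ∑ i, p i * w i ^ 2 ≤ 4.01 * N ^ 2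
  le_scale : 1.09 ≤ N

/-- The distribution function of `w`. -/
def cdf (p w : κ → ℝ) (t : ℝ) : ℝ := ∑ i with w i ≤ t, p i

/-- The expectation of the negative part of `w`. -/
def meanNeg (p w : κ → ℝ) : ℝ := ∑ i, p i * max (-w i) 0

namespace SubExp

variable {p w : κ → ℝ} {N : ℝ}

lemma neg (h : SubExp p w N) : SubExp p (fun i => -w i) N where
  nonneg := h.nonneg
  sum_eq_one := h.sum_eq_one
  mean := by simp [h.mean]
  mgf := h.mgf_neg
  mgf_neg := by simpa using h.mgf
  var := by simpa using h.var
  le_scale := h.le_scale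

lemma scale_pos (h : SubExp p w N) : 0 < N := by linarith [h.le_scale]

/-- Chernoff's bound with exponent 1/(4N). -/
lemma one_sub_exp_le_cdf (h : SubExp p w N) (t : ℝ) :
    1 - Real.exp (9 / 32 - t / (4 * N)) ≤ cdf p w t := by
  have hN := h.scale_pos
  have h1 : ∑ i with ¬ w i ≤ t, p i ≤ Real.exp (9 / 32 - t / (4 * N)) := by
    calc ∑ i with ¬ w i ≤ t, p i
        ≤ ∑ i with ¬ w i ≤ t, p i * Real.exp (w i / (4 * N)) * Real.exp (-(t / (4 * N))) := by
          refine Finset.sum_le_sum fun i hi => ?_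
          rw [mul_assoc, ← Real.exp_add]
          refine le_mul_of_one_le_right (h.nonneg i) (Real.one_le_exp ?_)
          have : t < w i := not_le.mp (Finset.mem_filter.mp hi).2
          have : t / (4 * N) ≤ w i / (4 * N) := by gcongr
          linarith
      _ ≤ ∑ i, p i * Real.exp (w i / (4 * N)) * Real.exp (-(t / (4 * N))) :=
          Finset.sum_le_univ_sum_of_nonneg fun i =>
            mul_nonneg (mul_nonneg (h.nonneg i) (Real.exp_pos _).le) (Real.exp_pos _).le
      _ ≤ Real.exp (9 / 32) * Real.exp (-(t / (4 * N))) := by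
          rw [← Finset.sum_mul]
          exact mul_le_mul_of_nonneg_right h.mgf (Real.exp_pos _).le
      _ = _ := by rw [← Real.exp_add]; ring_nf
  have h2 := Finset.sum_filter_add_sum_filter_not Finset.univ (fun i => w i ≤ t) p
  rw [h.sum_eq_one] at h2
  rw [cdf]
  linarith

lemma meanNeg_eq_sum_filter (p w : κ → ℝ) :
    meanNeg p w = ∑ i with w i ≤ 0, p i * -w i := by
  rw [meanNeg, Finset.sum_filter]
  refine Finset.sum_congr rfl fun i _ => ?_
  split_ifs with hi
  · rw [max_eq_left (by linarith)]
  · rw [max_eq_right (by linarith), mul_zero]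

/-- The mean negative part over an event of mass Q is of order N Q ln(1/Q). It follows by averaging
u ≤ exp(u - b) + b - 1 at u = -w/(4N), with b chosen so that exp(9/32 - b) = Q. -/
lemma meanNeg_le_of_cdf_le (h : SubExp p w N) {Q : ℝ} (hQ : 0 < Q) (hc : cdf p w 0 ≤ Q)
    (hb : 1 ≤ 9 / 32 - Real.log Q) : meanNeg p w ≤ 4 * N * (Q * (9 / 32 - Real.log Q)) := by
  have hN := h.scale_pos
  set b := 9 / 32 - Real.log Q with hbdef
  have hexp : Real.exp (9 / 32) * Real.exp (-b) = Q := by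
    rw [← Real.exp_add, hbdef]
    have : 9 / 32 + -(9 / 32 - Real.log Q) = Real.log Q := by ring
    rw [this, Real.exp_log hQ]
  have hpt : ∀ i, -w i ≤ 4 * N * (Real.exp (-w i / (4 * N)) * Real.exp (-b) + (b - 1)) := by
    intro i
    have h1 := Real.add_one_le_exp (-w i / (4 * N) - b)
    rw [sub_eq_add_neg, Real.exp_add] at h1
    have h2 : -w i = 4 * N * (-w i / (4 * N)) := by field_simp
    rw [h2]
    have h3 : 4 * N * (-w i / (4 * N)) / (4 * N) = -w i / (4 * N) := by field_simp
    rw [h3]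
    refine mul_le_mul_of_nonneg_left ?_ (by linarith)
    linarith
  calc meanNeg p w = ∑ i with w i ≤ 0, p i * -w i := meanNeg_eq_sum_filter p w
    _ ≤ ∑ i with w i ≤ 0,
          p i * (4 * N * (Real.exp (-w i / (4 * N)) * Real.exp (-b) + (b - 1))) :=
        Finset.sum_le_sum fun i _ => mul_le_mul_of_nonneg_left (hpt i) (h.nonneg i)
    _ = 4 * N * ((∑ i with w i ≤ 0, p i * Real.exp (-w i / (4 * N))) * Real.exp (-b)
          + (b - 1) * cdf p w 0) := by
        rw [cdf, Finset.sum_mul, Finset.mul_sum, ← Finset.sum_add_distrib, Finset.mul_sum]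
        exact Finset.sum_congr rfl fun i _ => by ring
    _ ≤ 4 * N * (Real.exp (9 / 32) * Real.exp (-b) + (b - 1) * Q) := by
        refine mul_le_mul_of_nonneg_left (add_le_add ?_ ?_) (by linarith)
        · refine mul_le_mul_of_nonneg_right (le_trans ?_ h.mgf_neg) (Real.exp_pos _).le
          exact Finset.sum_le_univ_sum_of_nonneg fun i =>
            mul_nonneg (h.nonneg i) (Real.exp_pos _).le
        · exact mul_le_mul_of_nonneg_left hc (by linarith)
    _ = 4 * N * (Q * b) := by rw [hexp]; ring

/-- Cauchy–Schwarz on the event w ≤ 0, with the variance bound. -/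
lemma sq_meanNeg_le (h : SubExp p w N) {Q : ℝ} (hc : cdf p w 0 ≤ Q) :
    meanNeg p w ^ 2 ≤ 4.01 * N ^ 2 * Q := by
  have h1 := Finset.sum_mul_sq_le_sq_mul_sq (Finset.univ.filter fun i => w i ≤ 0)
    (fun i => √(p i)) (fun i => √(p i) * -w i)
  have e1 : ∀ i, √(p i) * (√(p i) * -w i) = p i * -w i := fun i => by
    rw [← mul_assoc, Real.mul_self_sqrt (h.nonneg i)]
  have e2 : ∀ i, (√(p i) * -w i) ^ 2 = p i * w i ^ 2 := fun i => by
    rw [mul_pow, Real.sq_sqrt (h.nonneg i), neg_sq]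
  simp only [e1, e2, Real.sq_sqrt (h.nonneg _)] at h1
  rw [← meanNeg_eq_sum_filter] at h1
  have h2 : ∑ i with w i ≤ 0, p i * w i ^ 2 ≤ 4.01 * N ^ 2 :=
    le_trans (Finset.sum_le_univ_sum_of_nonneg fun i =>
      mul_nonneg (h.nonneg i) (sq_nonneg _)) h.var
  have h3 : 0 ≤ cdf p w 0 := Finset.sum_nonneg fun i _ => h.nonneg i
  calc meanNeg p w ^ 2 ≤ cdf p w 0 * ∑ i with w i ≤ 0, p i * w i ^ 2 := h1
    _ ≤ cdf p w 0 * (4.01 * N ^ 2) := mul_le_mul_of_nonneg_left h2 h3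
    _ ≤ Q * (4.01 * N ^ 2) := mul_le_mul_of_nonneg_right hc (by positivity)
    _ = _ := by ring

lemma sub_max_le_integral (x : ℝ) {T : ℝ} (hT : 0 ≤ T) :
    T - max x 0 ≤ ∫ t in (0 : ℝ)..T, if x ≤ t then (1 : ℝ) else 0 := by
  have hmono : Monotone fun t : ℝ => if x ≤ t then (1 : ℝ) else 0 := by
    intro s t hst
    dsimp only
    split_ifs with h1 h2
    · exact le_rfl
    · exact absurd (h1.trans hst) h2
    · exact zero_le_one
    · exact le_rfl
  have hnn : ∀ t : ℝ, 0 ≤ if x ≤ t then (1 : ℝ) else 0 := fun t => by split_ifs <;> norm_num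
  rcases le_total T (max x 0) with h | h
  · have : 0 ≤ ∫ t in (0 : ℝ)..T, if x ≤ t then (1 : ℝ) else 0 :=
      intervalIntegral.integral_nonneg hT fun t _ => hnn t
    linarith
  · rw [← intervalIntegral.integral_add_adjacent_intervals
      (hmono.intervalIntegrable (a := 0) (b := max x 0)) (hmono.intervalIntegrable (b := T))]
    have h1 : 0 ≤ ∫ t in (0 : ℝ)..(max x 0), if x ≤ t then (1 : ℝ) else 0 :=
      intervalIntegral.integral_nonneg (le_max_right _ _) fun t _ => hnn t
    have h2 : ∫ t in (max x 0)..T, (1 : ℝ) ≤ ∫ t in (max x 0)..T, if x ≤ t then (1 : ℝ) else 0 := by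
      refine intervalIntegral.integral_mono_on h (by simp) hmono.intervalIntegrable fun t ht => ?_
      rw [if_pos ((le_max_left _ _).trans ht.1)]
    rw [intervalIntegral.integral_const, smul_eq_mul, mul_one] at h2
    linarith

lemma integral_add_mul_exp (A B T : ℝ) {c : ℝ} (hc : c ≠ 0) :
    ∫ t in (0 : ℝ)..T, (A + B * Real.exp (c * t)) = A * T + B / c * (Real.exp (c * T) - 1) := by
  rw [intervalIntegral.integral_add (by simp)
    ((Continuous.intervalIntegrable (by fun_prop)) _ _), intervalIntegral.integral_const,
    intervalIntegral.integral_const_mul, intervalIntegral.integral_comp_mul_left _ hc, integral_exp]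
  simp
  ring

/-- If the distribution function is small on `[0, T]` then, the variable being centred, its
negative part has a large expectation. -/
lemma le_meanNeg (h : SubExp p w N) {A B c T : ℝ} (hc : c ≠ 0) (hT : 0 ≤ T)
    (hq : ∀ t, cdf p w t ≤ A + B * Real.exp (c * t)) :
    T - A * T - B / c * (Real.exp (c * T) - 1) ≤ meanNeg p w := by
  have hmono : ∀ i, Monotone fun t : ℝ => if w i ≤ t then (1 : ℝ) else 0 := by
    intro i s t hst
    dsimp only
    split_ifs with h1 h2
    · exact le_rfl
    · exact absurd (h1.trans hst) h2
    · exact zero_le_one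
    · exact le_rfl
  have hcdf : ∀ t, cdf p w t = ∑ i, p i * (if w i ≤ t then (1 : ℝ) else 0) := fun t => by
    rw [cdf, Finset.sum_filter]
    exact Finset.sum_congr rfl fun i _ => by split_ifs <;> simp
  have h1 : ∫ t in (0 : ℝ)..T, cdf p w t
      = ∑ i, p i * ∫ t in (0 : ℝ)..T, if w i ≤ t then (1 : ℝ) else 0 := by
    simp only [hcdf]
    rw [intervalIntegral.integral_finsetSum fun i _ =>
      ((hmono i).intervalIntegrable).const_mul _]
    simp only [intervalIntegral.integral_const_mul]
  have hint : IntervalIntegrable (cdf p w) MeasureTheory.volume 0 T := by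
    refine Monotone.intervalIntegrable fun s t hst => ?_
    rw [hcdf, hcdf]
    exact Finset.sum_le_sum fun i _ => mul_le_mul_of_nonneg_left (hmono i hst) (h.nonneg i)
  have h2 : ∫ t in (0 : ℝ)..T, cdf p w t ≤ ∫ t in (0 : ℝ)..T, (A + B * Real.exp (c * t)) :=
    intervalIntegral.integral_mono_on hT hint
      (Continuous.intervalIntegrable (by fun_prop) _ _) fun t _ => hq t
  rw [integral_add_mul_exp _ _ _ hc, h1] at h2
  have h3 : ∑ i, p i * (T - max (w i) 0)
      ≤ ∑ i, p i * ∫ t in (0 : ℝ)..T, if w i ≤ t then (1 : ℝ) else 0 :=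
    Finset.sum_le_sum fun i _ => mul_le_mul_of_nonneg_left (sub_max_le_integral _ hT) (h.nonneg i)
  -- Centring enters here: the positive and negative parts of w have the same mean.
  have h4 : ∑ i, p i * (T - max (w i) 0) = T - meanNeg p w := by
    have e : ∀ i, p i * (T - max (w i) 0) = p i * T - p i * w i - p i * max (-w i) 0 := by
      intro i
      rcases le_total (w i) 0 with hw | hw
      · rw [max_eq_right hw, max_eq_left (by linarith)]; ring
      · rw [max_eq_left hw, max_eq_right (by linarith)]; ring
    simp only [e, Finset.sum_sub_distrib, ← Finset.sum_mul, h.sum_eq_one, h.mean, meanNeg]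
    ring
  linarith

/-! ### Lower bounds for the distribution function with explicit constants. -/

lemma mul_exp_neg_le (u : ℝ) : u * Real.exp (-u) ≤ 0.3679 := by
  have h1 := Real.add_one_le_exp (u - 1)
  have h2 : u * Real.exp (-u) ≤ Real.exp (-1) := by
    calc u * Real.exp (-u) ≤ Real.exp (u - 1) * Real.exp (-u) :=
          mul_le_mul_of_nonneg_right (by linarith) (Real.exp_pos _).le
      _ = Real.exp (-1) := by rw [← Real.exp_add]; ring_nf
  have h3 := Real.exp_neg_one_lt_d9
  linarith

/-- Tangent line at f = 1/4, with 2.386 < 1 + 2 ln 2. -/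
lemma le_neg_log {f : ℝ} (hf : 0 < f) : 2.386 - 4 * f ≤ -Real.log f := by
  have h1 := Real.log_le_sub_one_of_pos (show 0 < 4 * f by linarith)
  rw [Real.log_mul (by norm_num) hf.ne'] at h1
  have h2 : Real.log 4 = 2 * Real.log 2 := by
    rw [show (4 : ℝ) = 2 ^ 2 by norm_num, Real.log_pow]; norm_num
  have h3 := Real.log_two_gt_d9
  linarith

/-- Chernoff gives a tail of at most exp(9/32 - 2Y) with Y = -ln(1 - f). The threshold 1/4 ensures Y
≥ ln(4/3) > 9/32, so that the tail is at most exp(-Y) = 1 - f. -/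
lemma le_cdf_of_quarter_le (h : SubExp p w N) {f τ : ℝ} (hf : 1 / 4 ≤ f) (hf1 : f < 1)
    (hτ : 8 * N * -Real.log (1 - f) ≤ τ) : f ≤ cdf p w τ := by
  have hN := h.scale_pos
  refine le_trans ?_ (h.one_sub_exp_le_cdf τ)
  have hY : 9 / 32 ≤ -Real.log (1 - f) := by
    have h1 : Real.log (1 - f) ≤ Real.log (3 / 4) := Real.log_le_log (by linarith) (by linarith)
    have h2 : Real.log (3 / 4) = Real.log 3 - 2 * Real.log 2 := by
      rw [Real.log_div (by norm_num) (by norm_num), show (4 : ℝ) = 2 ^ 2 by norm_num, Real.log_pow]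
      norm_num
    have h3 := Real.log_two_gt_d9
    have h4 : Real.log 3 ≤ 1.1 := by
      rw [Real.log_le_iff_le_exp (by norm_num)]
      have := Real.exp_one_gt_d9
      have h5 := Real.quadratic_le_exp_of_nonneg (show (0 : ℝ) ≤ 0.1 by norm_num)
      have h6 : Real.exp 1.1 = Real.exp 1 * Real.exp 0.1 := by rw [← Real.exp_add]; norm_num
      rw [h6]
      nlinarith
    linarith
  have h1 : 2 * -Real.log (1 - f) ≤ τ / (4 * N) := by
    rw [le_div_iff₀ (by linarith)]
    linarith
  have h2 : Real.exp (9 / 32 - τ / (4 * N)) ≤ Real.exp (Real.log (1 - f)) :=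
    Real.exp_le_exp.mpr (by linarith)
  rw [Real.exp_log (by linarith)] at h2
  linarith

/-- The two requirements are those that make √m and √(lam/μ) m at least f in
`exists_state_fidelity`; leaving t free is what makes small f accessible. If every t fails, the
distribution function lies below f² + f exp((t - 8Nf)/2) everywhere. Integrating this bounds the
mean negative part from below, and its value at 0 bounds that mean from above: by the exponential
moment if the second summand dominates at 0, by the variance if f² does. -/
lemma exists_cdf_ge_aux (h : SubExp p w N) {f : ℝ} (hf : 0 < f) (hf4 : f ≤ 1 / 4) :
    ∃ t, f ^ 2 ≤ cdf p w t ∧ f * Real.exp ((t - 8 * (N * f)) / 2) ≤ cdf p w t := by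
  by_contra! hcon
  have hN := h.le_scale
  set z := N * f with hz
  have hzf : 1.09 * f ≤ z := mul_le_mul_of_nonneg_right hN hf.le
  have hz0 : 0 < z := by linarith
  set l := -Real.log f with hl
  have hl1 : 2.386 - 4 * f ≤ l := le_neg_log hf
  have hfl : f = Real.exp (-l) := by rw [hl, neg_neg, Real.exp_log hf]
  have hq : ∀ t, cdf p w t ≤ f ^ 2 + f * Real.exp (-(4 * z)) * Real.exp (1 / 2 * t) := by
    intro t
    have e : f * Real.exp (-(4 * z)) * Real.exp (1 / 2 * t)
        = f * Real.exp ((t - 8 * z) / 2) := by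
      rw [mul_assoc, ← Real.exp_add]; ring_nf
    rw [e]
    have h1 : 0 < f * Real.exp ((t - 8 * z) / 2) := mul_pos hf (Real.exp_pos _)
    rcases lt_or_ge (cdf p w t) (f ^ 2) with h2 | h2
    · linarith
    · have := hcon t h2
      nlinarith
  -- At this T the exponential summand of the bound on the distribution function reaches 1.
  have hlow := h.le_meanNeg (T := 8 * z + 2 * l) (by norm_num) (by linarith) hq
  have hexp : f * Real.exp (-(4 * z)) * Real.exp (1 / 2 * (8 * z + 2 * l)) = 1 := by
    nth_rewrite 1 [hfl]
    rw [← Real.exp_add, ← Real.exp_add]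
    ring_nf
    exact Real.exp_zero
  have hfe : 0 < f * Real.exp (-(4 * z)) := mul_pos hf (Real.exp_pos _)
  have hlow2 : (8 * z + 2 * l) * (1 - f ^ 2) - 2 ≤ meanNeg p w := by nlinarith
  have hff : f ^ 2 ≤ 1 / 16 := by nlinarith
  have hlow3 : (8 * z + 2 * l) * (15 / 16) - 2 ≤ meanNeg p w := by nlinarith
  have hq0 := hq 0
  rw [mul_zero, Real.exp_zero, mul_one] at hq0
  rcases le_total f (Real.exp (-(4 * z))) with hc | hc
  · have hQ : cdf p w 0 ≤ 2 * (f * Real.exp (-(4 * z))) := by nlinarith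
    have hlog : Real.log (2 * (f * Real.exp (-(4 * z)))) = Real.log 2 - l - 4 * z := by
      rw [Real.log_mul (by norm_num) hfe.ne', Real.log_mul hf.ne' (Real.exp_pos _).ne',
        Real.log_exp, hl]
      ring
    have h2a := Real.log_two_gt_d9
    have h2b := Real.log_two_lt_d9
    have hup := h.meanNeg_le_of_cdf_le (by linarith) hQ (by rw [hlog]; linarith)
    rw [hlog] at hup
    have hb : 0 ≤ 9 / 32 - (Real.log 2 - l - 4 * z) := by linarith
    have h3 := mul_exp_neg_le (4 * z)
    have h4 : 4 * N * (2 * (f * Real.exp (-(4 * z))) * (9 / 32 - (Real.log 2 - l - 4 * z)))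
        = 2 * (4 * z * Real.exp (-(4 * z))) * (9 / 32 - (Real.log 2 - l - 4 * z)) := by
      rw [hz]; ring
    have h5 : 2 * (4 * z * Real.exp (-(4 * z))) * (9 / 32 - (Real.log 2 - l - 4 * z))
        ≤ 2 * 0.3679 * (9 / 32 - (Real.log 2 - l - 4 * z)) :=
      mul_le_mul_of_nonneg_right (by linarith) hb
    linarith
  · have hQ : cdf p w 0 ≤ 2 * f ^ 2 := by nlinarith
    have hup := h.sq_meanNeg_le hQ
    have h6 : 4.01 * N ^ 2 * (2 * f ^ 2) = 8.02 * z ^ 2 := by rw [hz]; ring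
    rw [h6] at hup
    have h7 : meanNeg p w ≤ 2.84 * z := by
      refine abs_le_of_sq_le_sq' ?_ (by linarith) |>.2
      nlinarith
    linarith

/-- Lower bounds for the distribution function, as needed for the achievability. -/
lemma exists_cdf_ge (h : SubExp p w N) {f τ : ℝ} (hf : 0 < f) (hf1 : f < 1)
    (hτ : 8 * N * -Real.log (1 - f) ≤ τ) :
    ∃ t, f ^ 2 ≤ cdf p w t ∧ f * Real.exp ((t - τ) / 2) ≤ cdf p w t := by
  rcases le_total f (1 / 4) with h4 | h4
  · obtain ⟨t, h1, h2⟩ := h.exists_cdf_ge_aux hf h4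
    refine ⟨t, h1, le_trans ?_ h2⟩
    refine mul_le_mul_of_nonneg_left (Real.exp_le_exp.mpr ?_) hf.le
    have h5 := Real.log_le_sub_one_of_pos (show 0 < 1 - f by linarith)
    have h6 : N * f ≤ N * -Real.log (1 - f) :=
      mul_le_mul_of_nonneg_left (by linarith) h.scale_pos.le
    linarith
  · have h1 := h.le_cdf_of_quarter_le h4 hf1 hτ
    refine ⟨τ, by nlinarith, ?_⟩
    simpa using h1

/-- The contradiction of `exists_cdf_ge_aux` with the comparison function 4x² + x exp(t - 8Nx). The
value 4x² makes the root of the distribution function at least 2x, as the smoothing loss in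
`le_dMaxSmooth` demands. -/
lemma exists_cdf_ge_aux' (h : SubExp p w N) {x : ℝ} (hx : 0 < x) (hx4 : x ≤ 1 / 4) :
    ∃ t, 4 * x ^ 2 ≤ cdf p w t ∧ x * Real.exp (t - 8 * (N * x)) ≤ cdf p w t := by
  by_contra! hcon
  have hN := h.le_scale
  set z := N * x with hz
  have hzf : 1.09 * x ≤ z := mul_le_mul_of_nonneg_right hN hx.le
  have hz0 : 0 < z := by linarith
  set l := -Real.log x with hl
  have hl1 : 2.386 - 4 * x ≤ l := le_neg_log hx
  have hxl : x = Real.exp (-l) := by rw [hl, neg_neg, Real.exp_log hx]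
  have hq : ∀ t, cdf p w t ≤ 4 * x ^ 2 + x * Real.exp (-(8 * z)) * Real.exp (1 * t) := by
    intro t
    have e : x * Real.exp (-(8 * z)) * Real.exp (1 * t) = x * Real.exp (t - 8 * z) := by
      rw [mul_assoc, ← Real.exp_add]; ring_nf
    rw [e]
    have h1 : 0 < x * Real.exp (t - 8 * z) := mul_pos hx (Real.exp_pos _)
    rcases lt_or_ge (cdf p w t) (4 * x ^ 2) with h2 | h2
    · linarith
    · have := hcon t h2
      nlinarith
  have hlow := h.le_meanNeg (T := 8 * z + l) (by norm_num) (by linarith) hq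
  have hexp : x * Real.exp (-(8 * z)) * Real.exp (1 * (8 * z + l)) = 1 := by
    nth_rewrite 1 [hxl]
    rw [← Real.exp_add, ← Real.exp_add]
    ring_nf
    exact Real.exp_zero
  have hfe : 0 < x * Real.exp (-(8 * z)) := mul_pos hx (Real.exp_pos _)
  have hlow2 : (8 * z + l) * (1 - 4 * x ^ 2) - 1 ≤ meanNeg p w := by nlinarith
  have hff : 4 * x ^ 2 ≤ 1 / 4 := by nlinarith
  have hlow3 : (8 * z + l) * (3 / 4) - 1 ≤ meanNeg p w := by nlinarith
  have hq0 := hq 0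
  rw [mul_zero, Real.exp_zero, mul_one] at hq0
  rcases le_total (4 * x) (Real.exp (-(8 * z))) with hc | hc
  · have hQ : cdf p w 0 ≤ 2 * (x * Real.exp (-(8 * z))) := by nlinarith
    have hlog : Real.log (2 * (x * Real.exp (-(8 * z)))) = Real.log 2 - l - 8 * z := by
      rw [Real.log_mul (by norm_num) hfe.ne', Real.log_mul hx.ne' (Real.exp_pos _).ne',
        Real.log_exp, hl]
      ring
    have h2a := Real.log_two_gt_d9
    have h2b := Real.log_two_lt_d9
    have hup := h.meanNeg_le_of_cdf_le (by linarith) hQ (by rw [hlog]; linarith)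
    rw [hlog] at hup
    have hb : 0 ≤ 9 / 32 - (Real.log 2 - l - 8 * z) := by linarith
    have h3 := mul_exp_neg_le (8 * z)
    have h4 : 4 * N * (2 * (x * Real.exp (-(8 * z))) * (9 / 32 - (Real.log 2 - l - 8 * z)))
        = (8 * z * Real.exp (-(8 * z))) * (9 / 32 - (Real.log 2 - l - 8 * z)) := by
      rw [hz]; ring
    have h5 : (8 * z * Real.exp (-(8 * z))) * (9 / 32 - (Real.log 2 - l - 8 * z))
        ≤ 0.3679 * (9 / 32 - (Real.log 2 - l - 8 * z)) :=
      mul_le_mul_of_nonneg_right h3 hb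
    linarith
  · have hQ : cdf p w 0 ≤ 8 * x ^ 2 := by nlinarith
    have hup := h.sq_meanNeg_le hQ
    have h6 : 4.01 * N ^ 2 * (8 * x ^ 2) = 32.08 * z ^ 2 := by rw [hz]; ring
    rw [h6] at hup
    have h7 : meanNeg p w ≤ 5.67 * z := by
      refine abs_le_of_sq_le_sq' ?_ (by linarith) |>.2
      nlinarith
    linarith

/-- Lower bounds for the distribution function, as needed for the converse. -/
lemma exists_cdf_ge' (h : SubExp p w N) {x τ : ℝ} (hx : 0 < x) (hx1 : x < 1)
    (hτ : 8 * N * -Real.log (1 - x) ≤ τ) :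
    x ≤ cdf p w τ ∨ ∃ t, 4 * x ^ 2 ≤ cdf p w t ∧ x * Real.exp (t - τ) ≤ cdf p w t := by
  rcases le_total x (1 / 4) with h4 | h4
  · obtain ⟨t, h1, h2⟩ := h.exists_cdf_ge_aux' hx h4
    refine Or.inr ⟨t, h1, le_trans ?_ h2⟩
    refine mul_le_mul_of_nonneg_left (Real.exp_le_exp.mpr ?_) hx.le
    have h5 := Real.log_le_sub_one_of_pos (show 0 < 1 - x by linarith)
    have h6 : N * x ≤ N * -Real.log (1 - x) :=
      mul_le_mul_of_nonneg_left (by linarith) h.scale_pos.le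
    linarith
  · exact Or.inl (h.le_cdf_of_quarter_le h4 hx1 hτ)

end SubExp

end Deviation

/-! ### Exponential moments of the log-likelihood ratio -/

section Moments

/-- Up to the factor β this is the derivative of cosh(βs) with respect to cosh s, so its
monotonicity is the concavity used next. The numerator of its own derivative vanishes at 0 and has
derivative (β² - 1) sinh(βs) sinh s ≤ 0. -/
lemma sinh_mul_div_sinh_antitoneOn {β : ℝ} (hβ0 : 0 ≤ β) (hβ1 : β ≤ 1) :
    AntitoneOn (fun s => Real.sinh (β * s) / Real.sinh s) (Set.Ioi 0) := by
  have hφ : AntitoneOn (fun s => β * Real.cosh (β * s) * Real.sinh s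
      - Real.sinh (β * s) * Real.cosh s) (Set.Ici 0) := by
    refine antitoneOn_of_hasDerivWithinAt_nonpos (convex_Ici 0)
      (f' := fun s => (β ^ 2 - 1) * (Real.sinh (β * s) * Real.sinh s)) (by fun_prop)
      (fun s _ => HasDerivAt.hasDerivWithinAt ?_) fun s hs => ?_
    · have h1 : HasDerivAt (fun s : ℝ => β * s) β s := by
        simpa using (hasDerivAt_id s).const_mul β
      have h2 := ((h1.cosh.const_mul β).mul (Real.hasDerivAt_sinh s)).sub
        (h1.sinh.mul (Real.hasDerivAt_cosh s))
      refine h2.congr_deriv ?_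
      ring
    · rw [interior_Ici, Set.mem_Ioi] at hs
      refine mul_nonpos_of_nonpos_of_nonneg (by nlinarith) (mul_nonneg ?_ ?_)
      · exact Real.sinh_nonneg_iff.mpr (mul_nonneg hβ0 hs.le)
      · exact Real.sinh_nonneg_iff.mpr hs.le
  have hpos : ∀ s : ℝ, 0 < s → 0 < Real.sinh s := fun s hs => Real.sinh_pos_iff.mpr hs
  refine antitoneOn_of_hasDerivWithinAt_nonpos (convex_Ioi 0)
    (f' := fun s => (β * Real.cosh (β * s) * Real.sinh s - Real.sinh (β * s) * Real.cosh s)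
      / Real.sinh s ^ 2) ?_ (fun s hs => HasDerivAt.hasDerivWithinAt ?_) fun s hs => ?_
  · exact ContinuousOn.div (by fun_prop) (by fun_prop) fun s hs => (hpos s hs).ne'
  · rw [interior_Ioi, Set.mem_Ioi] at hs
    have h1 : HasDerivAt (fun s : ℝ => β * s) β s := by
      simpa using (hasDerivAt_id s).const_mul β
    have h2 := h1.sinh.div (Real.hasDerivAt_sinh s) (hpos s hs).ne'
    refine h2.congr_deriv ?_
    ring
  · rw [interior_Ioi, Set.mem_Ioi] at hs
    refine div_nonpos_of_nonpos_of_nonneg ?_ (sq_nonneg _)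
    have := hφ (Set.mem_Ici.mpr le_rfl) (Set.mem_Ici.mpr hs.le) hs.le
    simpa using this

/-- `cosh (β s)` is a concave function of `cosh s`: tangent line inequality. -/
lemma cosh_mul_le {β l : ℝ} (hβ0 : 0 ≤ β) (hβ1 : β ≤ 1) (hl : 0 < l) (s : ℝ) :
    Real.cosh (β * s) ≤ Real.cosh (β * l)
      + β * (Real.sinh (β * l) / Real.sinh l) * (Real.cosh s - Real.cosh l) := by
  wlog hs : 0 ≤ s generalizing s
  · have := this (-s) (by linarith)
    rwa [mul_neg, Real.cosh_neg, Real.cosh_neg] at this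
  have hsl := Real.sinh_pos_iff.mpr hl
  set k := Real.sinh (β * l) / Real.sinh l with hk
  have hder : ∀ x, HasDerivAt (fun s => β * k * Real.cosh s - Real.cosh (β * s))
      (β * (k * Real.sinh x - Real.sinh (β * x))) x := fun x => by
    have h1 : HasDerivAt (fun s : ℝ => β * s) β x := by
      simpa using (hasDerivAt_id x).const_mul β
    refine (((Real.hasDerivAt_cosh x).const_mul (β * k)).sub h1.cosh).congr_deriv ?_
    ring
  have hanti := sinh_mul_div_sinh_antitoneOn hβ0 hβ1
  have hcont : Continuous fun s => β * k * Real.cosh s - Real.cosh (β * s) := by fun_prop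
  suffices h : β * k * Real.cosh l - Real.cosh (β * l) ≤ β * k * Real.cosh s - Real.cosh (β * s) by
    linarith
  rcases le_total s l with h | h
  · refine antitoneOn_of_hasDerivWithinAt_nonpos (convex_Icc 0 l) hcont.continuousOn
      (fun x _ => (hder x).hasDerivWithinAt) (fun x hx => ?_) ⟨hs, h⟩ ⟨hl.le, le_rfl⟩ h
    rw [interior_Icc] at hx
    have hx0 := Real.sinh_pos_iff.mpr hx.1
    have := hanti (Set.mem_Ioi.mpr hx.1) (Set.mem_Ioi.mpr hl) hx.2.le
    dsimp only at this
    rw [← hk, le_div_iff₀ hx0] at this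
    exact mul_nonpos_of_nonneg_of_nonpos hβ0 (by linarith)
  · refine monotoneOn_of_hasDerivWithinAt_nonneg (convex_Ici l) hcont.continuousOn
      (fun x _ => (hder x).hasDerivWithinAt) (fun x hx => ?_) (Set.mem_Ici.mpr le_rfl)
      (Set.mem_Ici.mpr h) h
    rw [interior_Ici, Set.mem_Ioi] at hx
    have hx0 := Real.sinh_pos_iff.mpr (hl.trans hx)
    have := hanti (Set.mem_Ioi.mpr hl) (Set.mem_Ioi.mpr (hl.trans hx)) hx.le
    dsimp only at this
    rw [← hk, div_le_iff₀ hx0] at this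
    exact mul_nonneg hβ0 (by linarith)

lemma one_add_sq_le_cosh (u : ℝ) : 1 + u ^ 2 / 2 ≤ Real.cosh u := by
  have h1 : Real.cosh u = 1 + 2 * Real.sinh (|u| / 2) ^ 2 := by
    rw [← Real.cosh_abs]
    have := Real.cosh_two_mul (|u| / 2)
    rw [mul_div_cancel₀ _ (two_ne_zero)] at this
    rw [this, Real.cosh_sq]
    ring
  have h2 : |u| / 2 ≤ Real.sinh (|u| / 2) := Real.self_le_sinh_iff.mpr (by positivity)
  have h3 : u ^ 2 = |u| ^ 2 := (sq_abs u).symm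
  have h4 : 0 ≤ |u| := abs_nonneg u
  rw [h1, h3]
  nlinarith

variable {κ : Type*} [Fintype κ] {p X : κ → ℝ} {η : ℝ}

lemma three_le_eta (hp : ∀ i, 0 ≤ p i) (hp1 : ∑ i, p i = 1)
    (hη : η = 1 + ∑ i, p i * (2 * Real.cosh (X i / 2))) : 3 ≤ η := by
  have : ∑ i, p i * 2 ≤ ∑ i, p i * (2 * Real.cosh (X i / 2)) :=
    Finset.sum_le_sum fun i _ => mul_le_mul_of_nonneg_left
      (by linarith [Real.one_le_cosh (X i / 2)]) (hp i)
  rw [← Finset.sum_mul, hp1] at this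
  linarith

lemma le_log_three : (1.09 : ℝ) ≤ Real.log 3 := by
  rw [Real.le_log_iff_exp_le (by norm_num)]
  have h1 : Real.exp 1.09 = Real.exp 1 * Real.exp 0.09 := by rw [← Real.exp_add]; norm_num
  have h2 := Real.exp_one_lt_d9
  have h3 := (abs_le.mp (Real.abs_exp_sub_one_sub_id_le (x := 0.09) (by norm_num [abs_le]))).2
  have h4 : Real.exp 0.09 ≤ 1.0981 := by norm_num at h3 ⊢; linarith
  rw [h1]
  have := Real.exp_pos 1
  nlinarith

/-- Jensen for cosh(βs) as a concave function of cosh s, in tangent form at s = ln η. It applies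
because E cosh(X/2) = (η - 1)/2 ≤ cosh(ln η). -/
lemma sum_cosh_le (hp : ∀ i, 0 ≤ p i) (hp1 : ∑ i, p i = 1)
    (hη : η = 1 + ∑ i, p i * (2 * Real.cosh (X i / 2))) {β : ℝ} (hβ0 : 0 ≤ β) (hβ1 : β ≤ 1) :
    ∑ i, p i * Real.cosh (β * (X i / 2)) ≤ Real.cosh (β * Real.log η) := by
  have hη3 := three_le_eta hp hp1 hη
  have hl : 0 < Real.log η := Real.log_pos (by linarith)
  have hcosh : ∑ i, p i * Real.cosh (X i / 2) ≤ Real.cosh (Real.log η) := by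
    have h1 : ∑ i, p i * (2 * Real.cosh (X i / 2)) = 2 * ∑ i, p i * Real.cosh (X i / 2) := by
      rw [Finset.mul_sum]
      exact Finset.sum_congr rfl fun i _ => by ring
    rw [Real.cosh_eq, Real.exp_neg, Real.exp_log (by linarith)]
    have : 0 < η⁻¹ := inv_pos.mpr (by linarith)
    linarith
  set k := β * (Real.sinh (β * Real.log η) / Real.sinh (Real.log η)) with hk
  have hk0 : 0 ≤ k := mul_nonneg hβ0 (div_nonneg
    (Real.sinh_nonneg_iff.mpr (mul_nonneg hβ0 hl.le)) (Real.sinh_nonneg_iff.mpr hl.le))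
  calc ∑ i, p i * Real.cosh (β * (X i / 2))
      ≤ ∑ i, p i * (Real.cosh (β * Real.log η)
          + k * (Real.cosh (X i / 2) - Real.cosh (Real.log η))) :=
        Finset.sum_le_sum fun i _ =>
          mul_le_mul_of_nonneg_left (cosh_mul_le hβ0 hβ1 hl _) (hp i)
    _ = Real.cosh (β * Real.log η) * ∑ i, p i + k * (∑ i, p i * Real.cosh (X i / 2)
          - Real.cosh (Real.log η) * ∑ i, p i) := by
        rw [mul_sub, ← mul_assoc k, Finset.mul_sum, Finset.mul_sum, Finset.mul_sum,
          ← Finset.sum_sub_distrib, ← Finset.sum_add_distrib]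
        exact Finset.sum_congr rfl fun i _ => by ring
    _ ≤ Real.cosh (β * Real.log η) := by
        rw [hp1, mul_one, mul_one]
        have := mul_nonneg hk0 (sub_nonneg.mpr hcosh)
        linarith

lemma sum_sq_le (hp : ∀ i, 0 ≤ p i) (hp1 : ∑ i, p i = 1)
    (hη : η = 1 + ∑ i, p i * (2 * Real.cosh (X i / 2))) :
    ∑ i, p i * X i ^ 2 ≤ 4.01 * Real.log η ^ 2 := by
  have hη3 := three_le_eta hp hp1 hη
  have hl : 1.09 ≤ Real.log η := le_log_three.trans (Real.log_le_log (by norm_num) hη3)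
  set l := Real.log η with hldef
  have hl0 : l ≠ 0 := by linarith
  have hβ1 : 1 / (20 * l) ≤ 1 := by rw [div_le_one (by linarith)]; linarith
  -- The second moment is the quadratic term of cosh at small β; β → 0 would give the constant 4,
  -- and this β gives 4.005.
  have h1 := sum_cosh_le hp hp1 hη (β := 1 / (20 * l)) (by positivity) hβ1
  have e1 : 1 / (20 * l) * l = 1 / 20 := by field_simp
  rw [← hldef, e1] at h1
  have h2 : Real.cosh (1 / 20) ≤ 1 + 1 / 800 + 1 / 640000 := by
    refine (Real.cosh_le_exp_half_sq _).trans ?_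
    have h3 := (abs_le.mp (Real.abs_exp_sub_one_sub_id_le (x := (1 / 20) ^ 2 / 2)
      (by norm_num [abs_le]))).2
    norm_num at h3 ⊢
    linarith
  have h4 : ∑ i, p i * (1 + (1 / (20 * l) * (X i / 2)) ^ 2 / 2)
      ≤ ∑ i, p i * Real.cosh (1 / (20 * l) * (X i / 2)) :=
    Finset.sum_le_sum fun i _ => mul_le_mul_of_nonneg_left (one_add_sq_le_cosh _) (hp i)
  have h5 : ∑ i, p i * (1 + (1 / (20 * l) * (X i / 2)) ^ 2 / 2)
      = 1 + (∑ i, p i * X i ^ 2) / (3200 * l ^ 2) := by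
    have e : ∀ i, p i * (1 + (1 / (20 * l) * (X i / 2)) ^ 2 / 2)
        = p i + p i * X i ^ 2 / (3200 * l ^ 2) := fun i => by
      field_simp
      ring
    simp only [e, Finset.sum_add_distrib, ← Finset.sum_div, hp1]
  have h6 : (∑ i, p i * X i ^ 2) / (3200 * l ^ 2) ≤ 1 / 800 + 1 / 640000 := by linarith
  rw [div_le_iff₀ (by positivity)] at h6
  have : 0 < l ^ 2 := by positivity
  linarith

lemma sum_exp_le (hp : ∀ i, 0 ≤ p i) (hp1 : ∑ i, p i = 1)
    (hη : η = 1 + ∑ i, p i * (2 * Real.cosh (X i / 2))) {n : ℕ} (hn : 1 ≤ n) {N : ℝ}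
    (hN : N = √n * Real.log η) :
    ∑ i, p i * Real.exp ((X i - ∑ j, p j * X j) / (4 * N)) ≤ Real.exp (9 / 32 / n) := by
  have hη3 := three_le_eta hp hp1 hη
  have hl : 1.09 ≤ Real.log η := le_log_three.trans (Real.log_le_log (by norm_num) hη3)
  have hn1 : (1 : ℝ) ≤ n := by exact_mod_cast hn
  have hsn : 1 ≤ √(n : ℝ) := by rw [Real.one_le_sqrt]; exact hn1
  have hN1 : 1 ≤ N := by rw [hN]; nlinarith
  have hβ1 : 1 / (2 * N) ≤ 1 := by rw [div_le_one (by linarith)]; linarith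
  have h1 := sum_cosh_le hp hp1 hη (β := 1 / (2 * N)) (by positivity) hβ1
  have hl0 : Real.log η ≠ 0 := by linarith
  have hsn0 : √(n : ℝ) ≠ 0 := by linarith
  have e1 : (1 / (2 * N) * Real.log η) ^ 2 / 2 = 1 / (8 * n) := by
    have h2 : (√(n : ℝ)) ^ 2 = n := Real.sq_sqrt (by linarith)
    have h3 : 1 / (2 * N) * Real.log η = 1 / (2 * √n) := by
      rw [hN]
      field_simp
    rw [h3, div_pow, mul_pow, h2]
    ring
  have h2 : Real.cosh (1 / (2 * N) * Real.log η) ≤ 1 + 9 / 64 / n := by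
    refine (Real.cosh_le_exp_half_sq _).trans ?_
    rw [e1]
    have hle : 1 / (8 * (n : ℝ)) ≤ 1 / 8 := by
      rw [div_le_div_iff₀ (by linarith) (by norm_num)]; linarith
    have hpos : 0 < 1 / (8 * (n : ℝ)) := by positivity
    have h3 := (abs_le.mp (Real.abs_exp_sub_one_sub_id_le (x := 1 / (8 * (n : ℝ)))
      (by rw [abs_of_pos hpos]; linarith))).2
    have h4 : (9 : ℝ) / 64 / n = 1 / (8 * n) + 1 / 8 * (1 / (8 * n)) := by
      field_simp; norm_num
    rw [h4]
    nlinarith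
  set d := ∑ j, p j * X j with hd
  -- The linear term averages to the mean d/(4N), which the centring removes. The excess 2
  -- (cosh(1/(2√n)) - 1) ≤ 9/(32 n) is small enough to survive n repetitions.
  have hpt : ∀ u : ℝ, Real.exp u ≤ u + 2 * Real.cosh u - 1 := fun u => by
    have := Real.add_one_le_exp (-u)
    rw [Real.cosh_eq]
    linarith
  have h3 : ∑ i, p i * Real.exp (X i / (4 * N)) ≤ Real.exp (d / (4 * N) + 9 / 32 / n) := by
    calc ∑ i, p i * Real.exp (X i / (4 * N))
        ≤ ∑ i, p i * (X i / (4 * N) + 2 * Real.cosh (1 / (2 * N) * (X i / 2)) - 1) := by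
          refine Finset.sum_le_sum fun i _ => mul_le_mul_of_nonneg_left ?_ (hp i)
          have : 1 / (2 * N) * (X i / 2) = X i / (4 * N) := by field_simp; ring
          rw [this]
          exact hpt _
      _ = d / (4 * N) + 2 * ∑ i, p i * Real.cosh (1 / (2 * N) * (X i / 2)) - ∑ i, p i := by
          rw [hd, Finset.sum_div, Finset.mul_sum, ← Finset.sum_add_distrib,
            ← Finset.sum_sub_distrib]
          exact Finset.sum_congr rfl fun i _ => by ring
      _ ≤ (d / (4 * N) + 9 / 32 / n) + 1 := by
          rw [hp1]
          have : (9 : ℝ) / 32 / n = 2 * (9 / 64 / n) := by ring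
          linarith
      _ ≤ _ := Real.add_one_le_exp _
  have h4 : ∀ i, p i * Real.exp ((X i - d) / (4 * N))
      = p i * Real.exp (X i / (4 * N)) * Real.exp (-(d / (4 * N))) := fun i => by
    rw [mul_assoc, ← Real.exp_add]; ring_nf
  simp only [h4, ← Finset.sum_mul]
  calc (∑ i, p i * Real.exp (X i / (4 * N))) * Real.exp (-(d / (4 * N)))
      ≤ Real.exp (d / (4 * N) + 9 / 32 / n) * Real.exp (-(d / (4 * N))) :=
        mul_le_mul_of_nonneg_right h3 (Real.exp_pos _).le
    _ = _ := by rw [← Real.exp_add]; ring_nf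

/-! ### Independent repetitions -/

lemma sum_prod_eq_pow [DecidableEq κ] (f : κ → ℝ) (n : ℕ) :
    ∑ I : Fin n → κ, ∏ k, f (I k) = (∑ i, f i) ^ n := by
  rw [Finset.sum_pow']
  simp

lemma sum_cons (n : ℕ) (f : (Fin (n + 1) → κ) → ℝ) :
    ∑ I, f I = ∑ a, ∑ I : Fin n → κ, f (Fin.cons a I) := by
  rw [← Fintype.sum_prod_type']
  exact (Fintype.sum_equiv (Fin.consEquiv fun _ => κ) _ _ fun x => rfl).symm

lemma moments_sum [DecidableEq κ] {x : κ → ℝ} (hp1 : ∑ i, p i = 1) (hx : ∑ i, p i * x i = 0)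
    (n : ℕ) :
    (∑ I : Fin n → κ, (∏ k, p (I k)) * ∑ k, x (I k) = 0) ∧
    ∑ I : Fin n → κ, (∏ k, p (I k)) * (∑ k, x (I k)) ^ 2 = n * ∑ i, p i * x i ^ 2 := by
  induction n with
  | zero => simp
  | succ n ih =>
    have hP : ∑ I : Fin n → κ, ∏ k, p (I k) = 1 := by rw [sum_prod_eq_pow, hp1, one_pow]
    constructor
    · rw [sum_cons]
      have e : ∀ a, ∀ I : Fin n → κ,
          (∏ k, p ((Fin.cons a I : Fin (n + 1) → κ) k))
            * ∑ k, x ((Fin.cons a I : Fin (n + 1) → κ) k)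
          = p a * x a * ∏ k, p (I k) + p a * ((∏ k, p (I k)) * ∑ k, x (I k)) := by
        intro a I
        rw [Fin.prod_univ_succ, Fin.sum_univ_succ]
        simp only [Fin.cons_zero, Fin.cons_succ]
        ring
      simp only [e, Finset.sum_add_distrib, ← Finset.mul_sum, hP, ih.1, mul_one, mul_zero, hx,
        add_zero]
    · rw [sum_cons]
      have e : ∀ a, ∀ I : Fin n → κ,
          (∏ k, p ((Fin.cons a I : Fin (n + 1) → κ) k))
            * (∑ k, x ((Fin.cons a I : Fin (n + 1) → κ) k)) ^ 2
          = p a * x a ^ 2 * ∏ k, p (I k) + 2 * (p a * x a) * ((∏ k, p (I k)) * ∑ k, x (I k))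
            + p a * ((∏ k, p (I k)) * (∑ k, x (I k)) ^ 2) := by
        intro a I
        rw [Fin.prod_univ_succ, Fin.sum_univ_succ]
        simp only [Fin.cons_zero, Fin.cons_succ]
        ring
      simp only [e, Finset.sum_add_distrib, ← Finset.mul_sum, hP, ih.1, ih.2, mul_one, mul_zero,
        add_zero, ← Finset.sum_mul, hp1]
      push_cast
      ring

/-- Over n independent copies the exponential moments exp(9/(32 n)) multiply to exp(9/32) and the
variances, each at most 4.01 ln² η, add. The scale is at least 1.09 because η ≥ 3. -/
lemma subExp_sum [DecidableEq κ] (hp : ∀ i, 0 ≤ p i) (hp1 : ∑ i, p i = 1)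
    (hη : η = 1 + ∑ i, p i * (2 * Real.cosh (X i / 2))) {n : ℕ} (hn : 1 ≤ n) :
    SubExp (fun I : Fin n → κ => ∏ k, p (I k))
      (fun I => ∑ k, (X (I k) - ∑ j, p j * X j)) (√n * Real.log η) := by
  have hη3 := three_le_eta hp hp1 hη
  have hl : 1.09 ≤ Real.log η := le_log_three.trans (Real.log_le_log (by norm_num) hη3)
  have hn1 : (1 : ℝ) ≤ n := by exact_mod_cast hn
  have hn0 : (n : ℝ) ≠ 0 := by linarith
  have hsn : 1 ≤ √(n : ℝ) := by rw [Real.one_le_sqrt]; exact hn1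
  set d := ∑ j, p j * X j with hd
  have hx : ∑ i, p i * (X i - d) = 0 := by
    simp only [mul_sub, Finset.sum_sub_distrib, ← Finset.sum_mul, hp1, ← hd]
    ring
  obtain ⟨hm1, hm2⟩ := moments_sum hp1 hx n
  have hmgf : ∀ y : κ → ℝ, ∑ i, p i * Real.exp (y i) ≤ Real.exp (9 / 32 / n) →
      ∑ I : Fin n → κ, (∏ k, p (I k)) * Real.exp (∑ k, y (I k)) ≤ Real.exp (9 / 32) := by
    intro y hy
    have e : ∀ I : Fin n → κ, (∏ k, p (I k)) * Real.exp (∑ k, y (I k))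
        = ∏ k, p (I k) * Real.exp (y (I k)) := fun I => by
      rw [Real.exp_sum, Finset.prod_mul_distrib]
    simp only [e]
    rw [sum_prod_eq_pow (fun i => p i * Real.exp (y i))]
    refine (pow_le_pow_left₀ (Finset.sum_nonneg fun i _ =>
      mul_nonneg (hp i) (Real.exp_pos _).le) hy n).trans (le_of_eq ?_)
    rw [← Real.exp_nat_mul, mul_div_cancel₀ _ hn0]
  refine ⟨fun I => Finset.prod_nonneg fun k _ => hp _, ?_, hm1, ?_, ?_, ?_, by nlinarith⟩
  · rw [sum_prod_eq_pow, hp1, one_pow]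
  · simp only [Finset.sum_div]
    exact hmgf (fun i => (X i - d) / (4 * (√n * Real.log η))) (sum_exp_le hp hp1 hη hn rfl)
  · simp only [← Finset.sum_neg_distrib, Finset.sum_div]
    refine hmgf (fun i => -(X i - d) / (4 * (√n * Real.log η))) ?_
    have hη' : η = 1 + ∑ i, p i * (2 * Real.cosh (-X i / 2)) := by
      rw [hη]
      congr 1
      refine Finset.sum_congr rfl fun i _ => ?_
      rw [neg_div, Real.cosh_neg]
    have := sum_exp_le (X := fun i => -X i) hp hp1 hη' hn rfl
    simp only [mul_neg, Finset.sum_neg_distrib, ← hd] at this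
    refine le_trans (le_of_eq ?_) this
    refine Finset.sum_congr rfl fun i _ => ?_
    congr 3
    ring
  · rw [hm2, mul_pow, Real.sq_sqrt (by linarith)]
    have h1 : ∑ i, p i * (X i - d) ^ 2 = ∑ i, p i * X i ^ 2 - d ^ 2 := by
      have : ∀ i, p i * (X i - d) ^ 2 = p i * X i ^ 2 - 2 * d * (p i * X i) + d ^ 2 * p i :=
        fun i => by ring
      simp only [this, Finset.sum_add_distrib, Finset.sum_sub_distrib, ← Finset.mul_sum, hp1, ← hd]
      ring
    have h2 := sum_sq_le hp hp1 hη
    have h3 : ∑ i, p i * (X i - d) ^ 2 ≤ 4.01 * Real.log η ^ 2 := by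
      rw [h1]; nlinarith [sq_nonneg d]
    nlinarith

lemma SubExp.comp_equiv {κ' : Type*} [Fintype κ'] {w : κ → ℝ} {N : ℝ} (h : SubExp p w N)
    (e : κ' ≃ κ) : SubExp (fun i => p (e i)) (fun i => w (e i)) N where
  nonneg _ := h.nonneg _
  sum_eq_one := (e.sum_comp p).trans h.sum_eq_one
  mean := (e.sum_comp fun i => p i * w i).trans h.mean
  mgf := (e.sum_comp fun i => p i * Real.exp (w i / (4 * N))).trans_le h.mgf
  mgf_neg := (e.sum_comp fun i => p i * Real.exp (-w i / (4 * N))).trans_le h.mgf_neg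
  var := (e.sum_comp fun i => p i * w i ^ 2).trans_le h.var
  le_scale := h.le_scale

end Moments

/-! ### One-shot bounds for the smooth max-relative entropy -/

lemma two_rpow_div_log (x : ℝ) : (2 : ℝ) ^ (x / Real.log 2) = Real.exp x := by
  have : Real.log 2 ≠ 0 := (Real.log_pos one_lt_two).ne'
  rw [Real.rpow_def_of_pos two_pos, mul_div_cancel₀ _ this]

/-- With lam = exp(c + τ) and μ = exp(c + t) one has r ≤ μ s on the event W ≤ t, so m is at least
the distribution function at t. The target fidelity f = √(1 - ε²) is then reached in either
alternative of `exists_state_fidelity`. -/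
lemma dMaxSmooth_le {V V' : Matrix ι ι ℂ} (hV : Vᴴ * V = 1) (hV' : V'ᴴ * V' = 1)
    {r s : ι → ℝ} (hr : ∀ i, 0 ≤ r i) (hs : ∀ i, 0 ≤ s i) (hρ : IsState (diagConj V r))
    (hσ : IsState (diagConj V' s)) {W : ι × ι → ℝ} {N c τ ε : ℝ}
    (h : SubExp (fun q : ι × ι => r q.1 * Complex.normSq ((Vᴴ * V') q.1 q.2)) W N)
    (hlog : ∀ q : ι × ι, r q.1 * Complex.normSq ((Vᴴ * V') q.1 q.2) ≠ 0 →
      r q.1 = s q.2 * Real.exp (W q + c))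
    (hcτ : 0 ≤ c + τ) (hε0 : 0 < ε) (hε1 : ε < 1)
    (hτ : 8 * N * -Real.log (1 - √(1 - ε ^ 2)) ≤ τ) :
    dMaxSmooth ε (diagConj V r) (diagConj V' s) ≤ (((c + τ) / Real.log 2 : ℝ) : EReal) := by
  set f := √(1 - ε ^ 2) with hf
  have hf0 : 0 < f := Real.sqrt_pos.mpr (by nlinarith)
  have hff : f ^ 2 = 1 - ε ^ 2 := Real.sq_sqrt (by nlinarith)
  have hf1 : f < 1 := by nlinarith
  obtain ⟨t, ht1, ht2⟩ := h.exists_cdf_ge hf0 hf1 hτ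
  set P : ι × ι → ℝ := fun q => r q.1 * Complex.normSq ((Vᴴ * V') q.1 q.2) with hP
  set μ := Real.exp (c + t) with hμ
  set m := ∑ i, ∑ j, min (r i) (μ * s j) * Complex.normSq ((Vᴴ * V') i j) with hm
  have hmcdf : cdf P W t ≤ m := by
    rw [hm, ← Fintype.sum_prod_type' (f := fun i j =>
      min (r i) (μ * s j) * Complex.normSq ((Vᴴ * V') i j)), cdf, Finset.sum_filter]
    refine Finset.sum_le_sum fun q _ => ?_
    have hnn : 0 ≤ min (r q.1) (μ * s q.2) * Complex.normSq ((Vᴴ * V') q.1 q.2) :=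
      mul_nonneg (le_min (hr _) (mul_nonneg (Real.exp_pos _).le (hs _))) (Complex.normSq_nonneg _)
    split_ifs with hq
    · by_cases h0 : P q = 0
      · rw [h0]; exact hnn
      · refine mul_le_mul_of_nonneg_right (le_min le_rfl ?_) (Complex.normSq_nonneg _)
        rw [hlog q h0, mul_comm]
        exact mul_le_mul_of_nonneg_right (Real.exp_le_exp.mpr (by linarith)) (hs _)
    · exact hnn
  have hm0 : 0 < m := lt_of_lt_of_le (by positivity) (ht1.trans hmcdf)
  obtain ⟨ω, hω, hωσ, hF⟩ := exists_state_fidelity hV hV' hr hs hσ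
    (lam := Real.exp (c + τ)) (μ := μ) (Real.one_le_exp hcτ) (Real.exp_pos _) hm hm0
  have hfF : f ≤ fidelity ω (diagConj V r) := by
    rcases hF with hF | hF
    · refine le_trans ?_ hF
      have e1 : √(Real.exp (c + τ) / μ) = Real.exp (-((t - τ) / 2)) := by
        rw [hμ, ← Real.exp_sub, ← Real.exp_half]
        ring_nf
      rw [e1]
      have h1 : f * Real.exp ((t - τ) / 2) ≤ m := ht2.trans hmcdf
      calc f = Real.exp (-((t - τ) / 2)) * (f * Real.exp ((t - τ) / 2)) := by
            rw [mul_left_comm, ← Real.exp_add, neg_add_cancel, Real.exp_zero, mul_one]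
        _ ≤ _ := mul_le_mul_of_nonneg_left h1 (Real.exp_pos _).le
    · refine le_trans ?_ hF
      rw [Real.le_sqrt hf0.le hm0.le]
      exact ht1.trans hmcdf
  have hball : ω ∈ ball ε (diagConj V r) := by
    refine ⟨hω, ?_⟩
    rw [dOp, hω.trace_re, hρ.trace_re, Real.sqrt_le_left hε0.le]
    nlinarith
  refine (iInf₂_le ω hball).trans (iInf₂_le ((c + τ) / Real.log 2) ?_)
  rw [two_rpow_div_log]
  exact hωσ

/-- With a = sin² α and π = sin² θ the hypothesis bounds cos(θ - α) from below, so sin(θ - α) ≤ ε.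
Then π - a = sin(θ - α) sin(θ + α), and for α ≤ θ also sin θ - sin α ≤ sin(θ - α). -/
lemma le_of_fidelity_bound {a π ε : ℝ} (ha0 : 0 ≤ a) (ha1 : a ≤ 1) (hπ0 : 0 ≤ π) (hπ1 : π ≤ 1)
    (hε0 : 0 ≤ ε) (hε1 : ε ≤ 1)
    (h : √(1 - ε ^ 2) ≤ √a * √π + √(1 - a) * √(1 - π)) :
    π - ε ≤ a ∧ √π - ε ≤ √a := by
  have hA := Real.sq_sqrt ha0
  have hB := Real.sq_sqrt hπ0
  have hA' := Real.sq_sqrt (sub_nonneg.mpr ha1)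
  have hB' := Real.sq_sqrt (sub_nonneg.mpr hπ1)
  have hE := Real.sq_sqrt (show 0 ≤ 1 - ε ^ 2 by nlinarith)
  have hA0 := Real.sqrt_nonneg a
  have hB0 := Real.sqrt_nonneg π
  have hA0' := Real.sqrt_nonneg (1 - a)
  have hB0' := Real.sqrt_nonneg (1 - π)
  have hE0 := Real.sqrt_nonneg (1 - ε ^ 2)
  have hBA : √a ≤ √π → √(1 - π) ≤ √(1 - a) := fun hle =>
    Real.sqrt_le_sqrt (by nlinarith)
  generalize √a = A at *
  generalize √π = B at *
  generalize √(1 - a) = A' at *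
  generalize √(1 - π) = B' at *
  generalize √(1 - ε ^ 2) = E at *
  have hid : (A * B + A' * B') ^ 2 + (B * A' - A * B') ^ 2 = 1 := by
    have : (A * B + A' * B') ^ 2 + (B * A' - A * B') ^ 2 = (A ^ 2 + A' ^ 2) * (B ^ 2 + B' ^ 2) := by
      ring
    rw [this, hA, hA', hB, hB']; ring
  have hid2 : (B * A' + A * B') ^ 2 + (A' * B' - A * B) ^ 2 = 1 := by
    have : (B * A' + A * B') ^ 2 + (A' * B' - A * B) ^ 2 = (A ^ 2 + A' ^ 2) * (B ^ 2 + B' ^ 2) := by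
      ring
    rw [this, hA, hA', hB, hB']; ring
  have hcross : B * A' - A * B' ≤ ε := by
    have h1 : E ^ 2 ≤ (A * B + A' * B') ^ 2 := pow_le_pow_left₀ hE0 h 2
    have h2 : (B * A' - A * B') ^ 2 ≤ ε ^ 2 := by linarith
    exact (abs_le_of_sq_le_sq' h2 hε0).2
  have hsum : B * A' + A * B' ≤ 1 := by nlinarith [sq_nonneg (A' * B' - A * B)]
  have hsum0 : 0 ≤ B * A' + A * B' := by positivity
  have hdiff : π - a = (B * A' - A * B') * (B * A' + A * B') := by
    have : (B * A' - A * B') * (B * A' + A * B') = B ^ 2 * A' ^ 2 - A ^ 2 * B' ^ 2 := by ring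
    rw [this, hA, hA', hB, hB']; ring
  constructor
  · have : (B * A' - A * B') * (B * A' + A * B') ≤ ε * 1 :=
      mul_le_mul hcross hsum hsum0 hε0
    linarith
  · rcases le_total B A with hBA' | hAB
    · linarith
    · have hB'A' := hBA hAB
      have hA'1 : A' ≤ 1 := by nlinarith
      have hB'1 : B' ≤ 1 := by nlinarith
      -- In terms of the angles, tan(α/2) ≤ tan(θ/2).
      have key : B * (1 - A') ≤ A * (1 - B') := by
        have e1 : (1 - A') * (1 + A') = A ^ 2 := by
          have : (1 - A') * (1 + A') = 1 - A' ^ 2 := by ring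
          rw [this, hA', hA]; ring
        have e2 : (1 - B') * (1 + B') = B ^ 2 := by
          have : (1 - B') * (1 + B') = 1 - B' ^ 2 := by ring
          rw [this, hB', hB]; ring
        have h1 : B * (1 - A') * ((1 + A') * (1 + B')) ≤ A * (1 - B') * ((1 + A') * (1 + B')) := by
          have l1 : B * (1 - A') * ((1 + A') * (1 + B')) = A * B * (A * (1 + B')) := by
            rw [show B * (1 - A') * ((1 + A') * (1 + B')) = B * ((1 - A') * (1 + A')) * (1 + B') by
              ring, e1]; ring
          have l2 : A * (1 - B') * ((1 + A') * (1 + B')) = A * B * (B * (1 + A')) := by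
            rw [show A * (1 - B') * ((1 + A') * (1 + B')) = A * ((1 - B') * (1 + B')) * (1 + A') by
              ring, e2]; ring
          rw [l1, l2]
          refine mul_le_mul_of_nonneg_left ?_ (mul_nonneg hA0 hB0)
          exact mul_le_mul hAB (by linarith) (by linarith) hB0
        exact le_of_mul_le_mul_right h1 (by positivity)
      linarith

/-- The converse is tested on the events r ≥ exp(c - t) s, which contain -W ≤ t on the support of P;
hence the deviation bounds are applied to the negated variable. -/
lemma le_dMaxSmooth {V V' : Matrix ι ι ℂ} (hV : Vᴴ * V = 1) (hV' : V'ᴴ * V' = 1)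
    {r s : ι → ℝ} (hr : ∀ i, 0 ≤ r i) (hs : ∀ i, 0 ≤ s i) (hρ : IsState (diagConj V r))
    {W : ι × ι → ℝ} {N c τ ε x : ℝ}
    (h : SubExp (fun q : ι × ι => r q.1 * Complex.normSq ((Vᴴ * V') q.1 q.2)) W N)
    (hlog : ∀ q : ι × ι, r q.1 * Complex.normSq ((Vᴴ * V') q.1 q.2) ≠ 0 →
      r q.1 = s q.2 * Real.exp (W q + c))
    (hε0 : 0 < ε) (hεx : ε < x) (hx1 : x < 1)
    (hτ : 8 * N * -Real.log (1 - x) ≤ τ) :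
    (((c - τ + Real.log (x - ε)) / Real.log 2 : ℝ) : EReal)
      ≤ dMaxSmooth ε (diagConj V r) (diagConj V' s) := by
  refine le_iInf₂ fun ω hω => le_iInf₂ fun γ hγ => ?_
  obtain ⟨hω, hd⟩ := hω
  rw [EReal.coe_le_coe_iff]
  have hx0 : 0 < x := hε0.trans hεx
  set P : ι × ι → ℝ := fun q => r q.1 * Complex.normSq ((Vᴴ * V') q.1 q.2) with hP
  have hr1 : ∑ i, r i = 1 := by
    have := hρ.2
    rw [diagConj_trace hV] at this
    exact_mod_cast this
  have hfid : √(1 - ε ^ 2) ≤ fidelity ω (diagConj V r) := by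
    have hF0 : 0 ≤ fidelity ω (diagConj V r) := by
      have := (nonneg_iff_posSemidef.mp (CFC.sqrt_nonneg
        (CFC.sqrt ω * diagConj V r * CFC.sqrt ω))).trace_nonneg
      exact (Complex.le_def.mp this).1
    rw [dOp, hω.trace_re, hρ.trace_re, Real.sqrt_le_left hε0.le] at hd
    rw [Real.sqrt_le_left hF0]
    linarith
  have hμ0 : 0 < (2 : ℝ) ^ γ := Real.rpow_pos_of_pos two_pos _
  have main : ∀ t, ∃ a, 0 ≤ a ∧ Real.exp (c - t) * a ≤ (2 : ℝ) ^ γ ∧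
      cdf P (fun q => -W q) t - ε ≤ a ∧ √(cdf P (fun q => -W q) t) - ε ≤ √a := by
    intro t
    obtain ⟨a, ha0, ha1, haμ, hF⟩ := fidelity_le_of_le hV hV' hr hs hr1 hω hμ0.le hγ
      (lam := Real.exp (c - t))
      (Finset.univ.filter fun q : ι × ι => Real.exp (c - t) * s q.2 ≤ r q.1)
      (fun q hq => (Finset.mem_filter.mp hq).2)
    set π := ∑ q : ι × ι with Real.exp (c - t) * s q.2 ≤ r q.1,
      r q.1 * Complex.normSq ((Vᴴ * V') q.1 q.2) with hπ
    have hπ0 : 0 ≤ π := Finset.sum_nonneg fun q _ => h.nonneg q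
    have hπ1 : π ≤ 1 := by
      rw [← h.sum_eq_one]
      exact Finset.sum_le_univ_sum_of_nonneg h.nonneg
    have hcdf : cdf P (fun q => -W q) t ≤ π := by
      rw [cdf, hπ, Finset.sum_filter, Finset.sum_filter]
      refine Finset.sum_le_sum fun q _ => ?_
      by_cases h0 : P q = 0
      · simp only [hP] at h0
        simp [hP, h0]
      · split_ifs with h1 h2
        · exact le_rfl
        · refine absurd ?_ h2
          rw [hlog q h0, mul_comm]
          exact mul_le_mul_of_nonneg_left (Real.exp_le_exp.mpr (by linarith)) (hs _)
        · exact h.nonneg q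
        · exact le_rfl
    obtain ⟨h1, h2⟩ := le_of_fidelity_bound ha0 ha1 hπ0 hπ1 hε0.le (hεx.trans hx1).le
      (hfid.trans hF)
    exact ⟨a, ha0, haμ, by linarith, by linarith [Real.sqrt_le_sqrt hcdf]⟩
  suffices hkey : Real.exp (c - τ) * (x - ε) ≤ (2 : ℝ) ^ γ by
    have hpos : 0 < Real.exp (c - τ) * (x - ε) := mul_pos (Real.exp_pos _) (by linarith)
    have h1 := Real.log_le_log hpos hkey
    rw [Real.log_rpow two_pos, Real.log_mul (Real.exp_pos _).ne' (by linarith), Real.log_exp] at h1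
    rwa [div_le_iff₀ (Real.log_pos one_lt_two)]
  rcases h.neg.exists_cdf_ge' hx0 hx1 hτ with h1 | ⟨t, h1, h2⟩
  · obtain ⟨a, -, haμ, ha1, -⟩ := main τ
    refine le_trans (mul_le_mul_of_nonneg_left ?_ (Real.exp_pos _).le) haμ
    linarith
  · obtain ⟨a, ha0, haμ, -, ha2⟩ := main t
    set g := √(cdf P (fun q => -W q) t) with hg
    set E := Real.exp (t - τ) with hE
    have hcdf0 : 0 ≤ cdf P (fun q => -W q) t := by nlinarith [sq_nonneg x]
    have hg2 : g ^ 2 = cdf P (fun q => -W q) t := Real.sq_sqrt hcdf0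
    have hgx : 2 * x ≤ g := by
      refine Real.le_sqrt_of_sq_le ?_
      linarith
    have hga : (g - ε) ^ 2 ≤ a := by
      rw [← Real.sq_sqrt ha0]
      exact pow_le_pow_left₀ (by linarith) ha2 2
    have hxE : (x - ε) * E ≤ (g - ε) ^ 2 := by
      have h3 : x * E ≤ g ^ 2 := by rw [hg2]; exact h2
      -- Uses x (g - ε)² - (x - ε) g² = ε g (g - 2x) + x ε², nonnegative since g ≥ 2x.
      have h4 : x * ((x - ε) * E) ≤ x * (g - ε) ^ 2 := by
        have h5 : (x - ε) * (x * E) ≤ (x - ε) * g ^ 2 :=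
          mul_le_mul_of_nonneg_left h3 (by linarith)
        have h6 : 0 ≤ ε * g * (g - 2 * x) :=
          mul_nonneg (mul_nonneg hε0.le (by linarith)) (by linarith)
        nlinarith [mul_pos hx0 (mul_pos hε0 hε0)]
      exact le_of_mul_le_mul_left h4 hx0
    have e : Real.exp (c - τ) * (x - ε) = Real.exp (c - t) * ((x - ε) * E) := by
      rw [hE, mul_left_comm, ← Real.exp_add, mul_comm]
      ring_nf
    rw [e]
    exact le_trans (mul_le_mul_of_nonneg_left (hxE.trans hga) (Real.exp_pos _).le) haμ

/-! ### The joint distribution of the eigenbases of two states -/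

lemma overlap_unitary {V V' : Matrix ι ι ℂ} (hV : Vᴴ * V = 1) (hV' : V'ᴴ * V' = 1) :
    (Vᴴ * V')ᴴ * (Vᴴ * V') = 1 := by
  rw [conjTranspose_mul, conjTranspose_conjTranspose, Matrix.mul_assoc,
    ← Matrix.mul_assoc V, mul_eq_one_comm.mp hV, Matrix.one_mul, hV']

lemma sum_normSq_col {U : Matrix ι ι ℂ} (hU : Uᴴ * U = 1) (j : ι) :
    ∑ i, Complex.normSq (U i j) = 1 := by
  have h1 : (Uᴴ * U) j j = 1 := by rw [hU, one_apply_eq]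
  rw [Matrix.mul_apply] at h1
  have h2 : ((∑ i, Complex.normSq (U i j) : ℝ) : ℂ) = 1 := by
    rw [← h1]
    push_cast
    exact Finset.sum_congr rfl fun i _ => by
      rw [conjTranspose_apply, Complex.star_def, mul_comm, Complex.mul_conj]
  exact_mod_cast h2

lemma sum_normSq_row {U : Matrix ι ι ℂ} (hU : Uᴴ * U = 1) (i : ι) :
    ∑ j, Complex.normSq (U i j) = 1 := by
  have hU' : Uᴴᴴ * Uᴴ = 1 := by
    rw [conjTranspose_conjTranspose]
    exact mul_eq_one_comm.mp hU
  rw [← sum_normSq_col hU' i]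
  refine Finset.sum_congr rfl fun j _ => ?_
  rw [conjTranspose_apply, Complex.star_def, Complex.normSq_conj]

/-- The image under ρ of its i-th eigenvector lies in the range of σ, so its component along an
eigenvector of σ with eigenvalue 0 vanishes; that component is r i times a conjugated overlap. -/
lemma eigenvalue_ne_zero_of_supp_le {V V' : Matrix ι ι ℂ} (hV : Vᴴ * V = 1) (hV' : V'ᴴ * V' = 1)
    {r s : ι → ℝ} (h : supp (diagConj V r) ≤ supp (diagConj V' s)) {i j : ι}
    (hij : r i * Complex.normSq ((Vᴴ * V') i j) ≠ 0) : s j ≠ 0 := by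
  intro hsj
  obtain ⟨y, hy⟩ := h ⟨V *ᵥ Pi.single i 1, rfl⟩
  rw [mulVecLin_apply, mulVecLin_apply] at hy
  have h1 : V'ᴴ *ᵥ (diagConj V' s *ᵥ y)
      = diagonal (fun i => (s i : ℂ)) *ᵥ (V'ᴴ *ᵥ y) := by
    rw [mulVec_mulVec, mulVec_mulVec]
    congr 1
    rw [diagConj, ← Matrix.mul_assoc, ← Matrix.mul_assoc, hV', Matrix.one_mul]
  have h2 : V'ᴴ *ᵥ (diagConj V r *ᵥ (V *ᵥ Pi.single i 1))
      = ((Vᴴ * V')ᴴ * diagonal (fun i => (r i : ℂ))) *ᵥ Pi.single i 1 := by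
    rw [mulVec_mulVec, mulVec_mulVec]
    congr 1
    rw [diagConj, conjTranspose_mul, conjTranspose_conjTranspose]
    simp only [Matrix.mul_assoc, hV, Matrix.mul_one]
  have h3 := congrFun (h2.symm.trans ((congrArg _ hy.symm).trans h1)) j
  rw [mulVec_diagonal, hsj, Complex.ofReal_zero, zero_mul, mulVec_single_one, col_apply,
    Matrix.mul_diagonal, conjTranspose_apply] at h3
  rcases mul_eq_zero.mp h3 with h4 | h4
  · apply hij
    rw [star_eq_zero.mp h4]
    simp
  · apply hij
    rw [Complex.ofReal_eq_zero.mp h4, zero_mul]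

/-- The joint distribution of the eigenbases, weighted by the eigenvalues of the first state. -/
def overlapDist (V V' : Matrix ι ι ℂ) (r : ι → ℝ) (q : ι × ι) : ℝ :=
  r q.1 * Complex.normSq ((Vᴴ * V') q.1 q.2)

/-- The log-likelihood ratio of the eigenvalues. -/
def logRatio (r s : ι → ℝ) (q : ι × ι) : ℝ := Real.log (r q.1) - Real.log (s q.2)

lemma overlapDist_nonneg (V V' : Matrix ι ι ℂ) {r : ι → ℝ} (hr : ∀ i, 0 ≤ r i) (q : ι × ι) :
    0 ≤ overlapDist V V' r q := mul_nonneg (hr _) (Complex.normSq_nonneg _)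

lemma sum_overlapDist {V V' : Matrix ι ι ℂ} (hV : Vᴴ * V = 1) (hV' : V'ᴴ * V' = 1)
    (r : ι → ℝ) : ∑ q, overlapDist V V' r q = ∑ i, r i := by
  rw [Fintype.sum_prod_type]
  refine Finset.sum_congr rfl fun i _ => ?_
  simp only [overlapDist]
  rw [← Finset.mul_sum, sum_normSq_row (overlap_unitary hV hV'), mul_one]

section Pair

variable {V V' : Matrix ι ι ℂ} {r s : ι → ℝ}

lemma eq_mul_exp_logRatio (hV : Vᴴ * V = 1) (hV' : V'ᴴ * V' = 1)
    (hr : ∀ i, 0 ≤ r i) (hs : ∀ i, 0 ≤ s i)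
    (h : supp (diagConj V r) ≤ supp (diagConj V' s)) {q : ι × ι}
    (hq : overlapDist V V' r q ≠ 0) :
    0 < r q.1 ∧ 0 < s q.2 ∧ r q.1 = s q.2 * Real.exp (logRatio r s q) := by
  have hr0 : 0 < r q.1 := lt_of_le_of_ne (hr _) fun h0 => hq (by rw [overlapDist, ← h0, zero_mul])
  have hs0 : 0 < s q.2 :=
    lt_of_le_of_ne (hs _) (Ne.symm (eigenvalue_ne_zero_of_supp_le hV hV' h hq))
  refine ⟨hr0, hs0, ?_⟩
  rw [logRatio, Real.exp_sub, Real.exp_log hr0, Real.exp_log hs0]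
  field_simp

lemma sum_overlapDist_mul_logRatio (hV : Vᴴ * V = 1) (hV' : V'ᴴ * V' = 1) :
    (diagConj V r * (diagConj V (fun i => Real.logb 2 (r i))
      - diagConj V' (fun i => Real.logb 2 (s i)))).trace.re
      = (∑ q, overlapDist V V' r q * logRatio r s q) / Real.log 2 := by
  rw [Matrix.mul_sub, trace_sub, Complex.sub_re, diagConj_mul hV, diagConj_trace hV,
    Complex.ofReal_re, trace_diagConj_mul, Fintype.sum_prod_type, Finset.sum_div,
    ← Finset.sum_sub_distrib]
  refine Finset.sum_congr rfl fun i _ => ?_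
  have h1 : r i * Real.logb 2 (r i)
      = ∑ j, r i * Real.logb 2 (r i) * Complex.normSq ((Vᴴ * V') i j) := by
    rw [← Finset.mul_sum, sum_normSq_row (overlap_unitary hV hV'), mul_one]
  rw [h1, ← Finset.sum_sub_distrib, Finset.sum_div]
  refine Finset.sum_congr rfl fun j _ => ?_
  simp only [overlapDist, logRatio, Real.logb]
  ring

/-- Gibbs' inequality against the distribution s_j |U i j|². It serves to make lam = exp(n d + τ) at
least 1, without which no state lies below lam σ. -/
lemma sum_overlapDist_mul_logRatio_nonneg (hV : Vᴴ * V = 1) (hV' : V'ᴴ * V' = 1)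
    (hr : ∀ i, 0 ≤ r i) (hs : ∀ i, 0 ≤ s i) (hr1 : ∑ i, r i = 1) (hs1 : ∑ i, s i = 1)
    (h : supp (diagConj V r) ≤ supp (diagConj V' s)) :
    0 ≤ ∑ q, overlapDist V V' r q * logRatio r s q := by
  have hpt : ∀ q, overlapDist V V' r q - s q.2 * Complex.normSq ((Vᴴ * V') q.1 q.2)
      ≤ overlapDist V V' r q * logRatio r s q := by
    intro q
    have hn := Complex.normSq_nonneg ((Vᴴ * V') q.1 q.2)
    by_cases hq : overlapDist V V' r q = 0
    · rw [hq]
      have := mul_nonneg (hs q.2) hn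
      linarith
    · obtain ⟨hr0, hs0, he⟩ := eq_mul_exp_logRatio hV hV' hr hs h hq
      have h1 := Real.add_one_le_exp (-logRatio r s q)
      have h2 : s q.2 = r q.1 * Real.exp (-logRatio r s q) := by
        rw [he, mul_assoc, ← Real.exp_add, add_neg_cancel, Real.exp_zero, mul_one]
      have h3 : s q.2 * Complex.normSq ((Vᴴ * V') q.1 q.2)
          = overlapDist V V' r q * Real.exp (-logRatio r s q) := by
        nth_rewrite 1 [h2]
        rw [overlapDist]; ring
      rw [h3]
      have := mul_le_mul_of_nonneg_left h1 (overlapDist_nonneg V V' hr q)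
      linarith
  have h2 := Finset.sum_le_sum fun q (_ : q ∈ Finset.univ) => hpt q
  rw [Finset.sum_sub_distrib, sum_overlapDist hV hV', hr1] at h2
  have h3 : ∑ q : ι × ι, s q.2 * Complex.normSq ((Vᴴ * V') q.1 q.2) = 1 := by
    rw [Fintype.sum_prod_type, Finset.sum_comm, ← hs1]
    refine Finset.sum_congr rfl fun j _ => ?_
    dsimp only
    rw [← Finset.mul_sum, sum_normSq_col (overlap_unitary hV hV'), mul_one]
  linarith

/-- On the support of the joint distribution r^{3/2} s^{-1/2} = r exp(X/2) and r^{1/2} s^{1/2} = r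
exp(-X/2). Off it both sides vanish, as r = 0 or the overlap is zero. -/
lemma eta_term (hV : Vᴴ * V = 1) (hV' : V'ᴴ * V' = 1)
    (hr : ∀ i, 0 ≤ r i) (hs : ∀ i, 0 ≤ s i)
    (h : supp (diagConj V r) ≤ supp (diagConj V' s)) :
    1 + (diagConj V (fun i => r i ^ (3 / 2 : ℝ))
          * diagConj V' (fun i => s i ^ (-1 / 2 : ℝ))).trace.re
      + (diagConj V (fun i => r i ^ (1 / 2 : ℝ))
          * diagConj V' (fun i => s i ^ (1 / 2 : ℝ))).trace.re
      = 1 + ∑ q, overlapDist V V' r q * (2 * Real.cosh (logRatio r s q / 2)) := by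
  rw [trace_diagConj_mul, trace_diagConj_mul, add_assoc, ← Finset.sum_add_distrib,
    Fintype.sum_prod_type]
  congr 1
  refine Finset.sum_congr rfl fun i _ => ?_
  rw [← Finset.sum_add_distrib]
  refine Finset.sum_congr rfl fun j _ => ?_
  by_cases hq : overlapDist V V' r (i, j) = 0
  · rw [hq, zero_mul]
    rcases mul_eq_zero.mp hq with h0 | h0
    · dsimp only at h0
      rw [h0, Real.zero_rpow (by norm_num), Real.zero_rpow (by norm_num)]
      ring
    · dsimp only at h0
      rw [h0]
      ring
  · obtain ⟨hr0, hs0, -⟩ := eq_mul_exp_logRatio hV hV' hr hs h hq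
    dsimp only at hr0 hs0
    have e1 : r i ^ (3 / 2 : ℝ) * s j ^ (-1 / 2 : ℝ)
        = r i * Real.exp (logRatio r s (i, j) / 2) := by
      rw [Real.rpow_def_of_pos hr0, Real.rpow_def_of_pos hs0, ← Real.exp_add]
      nth_rewrite 2 [← Real.exp_log hr0]
      rw [← Real.exp_add, logRatio]
      ring_nf
    have e2 : r i ^ (1 / 2 : ℝ) * s j ^ (1 / 2 : ℝ)
        = r i * Real.exp (-(logRatio r s (i, j) / 2)) := by
      rw [Real.rpow_def_of_pos hr0, Real.rpow_def_of_pos hs0, ← Real.exp_add]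
      nth_rewrite 2 [← Real.exp_log hr0]
      rw [← Real.exp_add, logRatio]
      ring_nf
    rw [e1, e2, overlapDist, Real.cosh_eq]
    ring

/-! ### Tensor powers of two states -/

lemma overlapDist_tensorPow (n : ℕ) (q : (Fin n → ι) × (Fin n → ι)) :
    overlapDist (tensorPow V n) (tensorPow V' n) (fun I => ∏ k, r (I k)) q
      = ∏ k, overlapDist V V' r (q.1 k, q.2 k) := by
  simp only [overlapDist]
  rw [← tensorPow_conjTranspose, ← tensorPow_mul, Finset.prod_mul_distrib, tensorPow, of_apply,
    map_prod]

lemma isState_tensorPow (hV : Vᴴ * V = 1) (hr : ∀ i, 0 ≤ r i) (hr1 : ∑ i, r i = 1) (n : ℕ) :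
    IsState (diagConj (tensorPow V n) (fun I : Fin n → ι => ∏ k, r (I k))) := by
  refine ⟨diagConj_posSemidef _ fun I => Finset.prod_nonneg fun k _ => hr _, ?_⟩
  rw [diagConj_trace (tensorPow_unitary hV n), sum_prod_eq_pow, hr1]
  simp

lemma subExp_tensorPow (hV : Vᴴ * V = 1) (hV' : V'ᴴ * V' = 1)
    (hr : ∀ i, 0 ≤ r i) (hr1 : ∑ i, r i = 1) {η d : ℝ}
    (hη : η = 1 + ∑ q, overlapDist V V' r q * (2 * Real.cosh (logRatio r s q / 2)))
    (hd : d = ∑ q, overlapDist V V' r q * logRatio r s q) {n : ℕ} (hn : 1 ≤ n) :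
    SubExp (overlapDist (tensorPow V n) (tensorPow V' n) (fun I : Fin n → ι => ∏ k, r (I k)))
      (fun q => ∑ k, (logRatio r s (q.1 k, q.2 k) - d)) (√n * Real.log η) := by
  have h := subExp_sum (overlapDist_nonneg V V' hr) ((sum_overlapDist hV hV' r).trans hr1) hη hn
  rw [← hd] at h
  have h2 := h.comp_equiv (Equiv.arrowProdEquivProdArrow (Fin n) (fun _ => ι) (fun _ => ι)).symm
  convert! h2 using 1
  ext q
  exact overlapDist_tensorPow n q

lemma eq_mul_exp_tensorPow (hV : Vᴴ * V = 1) (hV' : V'ᴴ * V' = 1)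
    (hr : ∀ i, 0 ≤ r i) (hs : ∀ i, 0 ≤ s i)
    (h : supp (diagConj V r) ≤ supp (diagConj V' s)) (d : ℝ) {n : ℕ}
    {q : (Fin n → ι) × (Fin n → ι)}
    (hq : overlapDist (tensorPow V n) (tensorPow V' n) (fun I => ∏ k, r (I k)) q ≠ 0) :
    ∏ k, r (q.1 k) = (∏ k, s (q.2 k))
      * Real.exp (∑ k, (logRatio r s (q.1 k, q.2 k) - d) + n * d) := by
  rw [overlapDist_tensorPow, Finset.prod_ne_zero_iff] at hq
  have e : ∑ k, (logRatio r s (q.1 k, q.2 k) - d) + n * d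
      = ∑ k, logRatio r s (q.1 k, q.2 k) := by
    rw [Finset.sum_sub_distrib]
    simp
  rw [e, Real.exp_sum, ← Finset.prod_mul_distrib]
  exact Finset.prod_congr rfl fun k hk =>
    (eq_mul_exp_logRatio hV hV' hr hs h (hq k hk)).2.2

end Pair

/-! ### The asymptotic equipartition property -/

lemma relEntropy_eq_coe {ρ σ : Matrix ι ι ℂ} (h : supp ρ ≤ supp σ) :
    relEntropy ρ σ = (((ρ * (matLog ρ - matLog σ)).trace.re : ℝ) : EReal) := if_pos h

/-- The constant 4√2 for binary logarithms becomes 4√2 / ln 2 ≈ 8.16 in natural ones, just above the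
8 of the deviation bounds. -/
lemma eight_le : 8 ≤ 4 * √2 / Real.log 2 := by
  have h1 := Real.log_two_lt_d9
  have h2 : (1.4 : ℝ) ≤ √2 := Real.le_sqrt_of_sq_le (by norm_num)
  rw [le_div_iff₀ (Real.log_pos one_lt_two)]
  linarith

/-- Both finite-size bounds, before division by `n`. -/
lemma dMaxSmooth_tensorPow_bounds {ρ σ : Matrix ι ι ℂ} (hρ : IsState ρ) (hσ : IsState σ)
    (hsupp : supp ρ ≤ supp σ) {ε : ℝ} (hε0 : 0 < ε) {n : ℕ} (hn : 1 ≤ n) :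
    (ε < 1 → dMaxSmooth ε (tensorPow ρ n) (tensorPow σ n)
      ≤ ((n * (ρ * (matLog ρ - matLog σ)).trace.re + √n * (4 * √2) * Real.logb 2 (eta ρ σ)
          * Real.logb 2 ((1 - √(1 - ε ^ 2))⁻¹) : ℝ) : EReal)) ∧
    ∀ x, ε < x → x < 1 →
      ((n * (ρ * (matLog ρ - matLog σ)).trace.re - √n * (4 * √2) * Real.logb 2 (eta ρ σ)
          * Real.logb 2 ((1 - x)⁻¹) - Real.logb 2 (1 / (x - ε)) : ℝ) : EReal)
      ≤ dMaxSmooth ε (tensorPow ρ n) (tensorPow σ n) := by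
  obtain ⟨V, r, hV, hρV, hcfcρ⟩ := exists_diagConj hρ.1.1
  obtain ⟨V', s, hV', hσV, hcfcσ⟩ := exists_diagConj hσ.1.1
  have hr := eigenvalues_nonneg_of_diagConj hV (hρV ▸ hρ.1)
  have hs := eigenvalues_nonneg_of_diagConj hV' (hσV ▸ hσ.1)
  have hr1 : ∑ i, r i = 1 := by
    have := hρ.2
    rw [hρV, diagConj_trace hV] at this
    exact_mod_cast this
  have hs1 : ∑ i, s i = 1 := by
    have := hσ.2
    rw [hσV, diagConj_trace hV'] at this
    exact_mod_cast this
  have hρ0 : (0 : Matrix ι ι ℂ) ≤ ρ := nonneg_iff_posSemidef.mpr hρ.1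
  have hσ0 : (0 : Matrix ι ι ℂ) ≤ σ := nonneg_iff_posSemidef.mpr hσ.1
  have hsupp' : supp (diagConj V r) ≤ supp (diagConj V' s) := by rwa [← hρV, ← hσV]
  have hη : eta ρ σ = 1 + ∑ q, overlapDist V V' r q * (2 * Real.cosh (logRatio r s q / 2)) := by
    rw [eta, CFC.rpow_eq_cfc_real hρ0, CFC.rpow_eq_cfc_real hσ0, CFC.rpow_eq_cfc_real hρ0,
      CFC.rpow_eq_cfc_real hσ0, hcfcρ, hcfcρ, hcfcσ, hcfcσ]
    exact eta_term hV hV' hr hs hsupp'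
  have hD : (ρ * (matLog ρ - matLog σ)).trace.re
      = (∑ q, overlapDist V V' r q * logRatio r s q) / Real.log 2 := by
    rw [matLog, matLog, hcfcρ, hcfcσ, ← sum_overlapDist_mul_logRatio hV hV', ← hρV]
  have hd0 := sum_overlapDist_mul_logRatio_nonneg hV hV' hr hs hr1 hs1 hsupp'
  set d := ∑ q, overlapDist V V' r q * logRatio r s q with hd
  have hη3 : 3 ≤ eta ρ σ :=
    three_le_eta (overlapDist_nonneg V V' hr) ((sum_overlapDist hV hV' r).trans hr1) hη
  have hl0 : 0 ≤ Real.log (eta ρ σ) := Real.log_nonneg (by linarith)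
  have hsub := subExp_tensorPow hV hV' hr hr1 hη hd hn
  have hlog2 := Real.log_pos one_lt_two
  have hτ : ∀ y, 0 ≤ y → 8 * (√n * Real.log (eta ρ σ)) * y
      ≤ 4 * √2 / Real.log 2 * (√n * Real.log (eta ρ σ)) * y := fun y hy =>
    mul_le_mul_of_nonneg_right (mul_le_mul_of_nonneg_right eight_le
      (mul_nonneg (Real.sqrt_nonneg _) hl0)) hy
  have hnd : 0 ≤ n * d := mul_nonneg (Nat.cast_nonneg n) hd0
  -- The backward rewrites restore ρ and σ inside `eta` once the tensor powers are in diagonal form.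
  rw [hD, hρV, hσV, tensorPow_diagConj, tensorPow_diagConj, ← hρV, ← hσV]
  have hRn : ∀ I : Fin n → ι, 0 ≤ ∏ k, r (I k) := fun I => Finset.prod_nonneg fun k _ => hr _
  have hSn : ∀ I : Fin n → ι, 0 ≤ ∏ k, s (I k) := fun I => Finset.prod_nonneg fun k _ => hs _
  constructor
  · intro hε1
    have hf0 : 0 < √(1 - ε ^ 2) := Real.sqrt_pos.mpr (by nlinarith)
    have hff : √(1 - ε ^ 2) ^ 2 = 1 - ε ^ 2 := Real.sq_sqrt (by nlinarith)
    have hf1 : √(1 - ε ^ 2) < 1 := by nlinarith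
    have hy : 0 ≤ -Real.log (1 - √(1 - ε ^ 2)) := by
      have := Real.log_nonpos (sub_nonneg.mpr hf1.le) (by linarith)
      linarith
    refine (dMaxSmooth_le (tensorPow_unitary hV n) (tensorPow_unitary hV' n) hRn hSn
      (isState_tensorPow hV hr hr1 n) (isState_tensorPow hV' hs hs1 n) hsub
      (fun q hq => eq_mul_exp_tensorPow hV hV' hr hs hsupp' d hq) ?_ hε0 hε1
      (hτ _ hy)).trans (le_of_eq ?_)
    · have := mul_nonneg (mul_nonneg (show 0 ≤ 4 * √2 / Real.log 2 by positivity)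
        (mul_nonneg (Real.sqrt_nonneg (n : ℝ)) hl0)) hy
      linarith
    · congr 1
      simp only [Real.logb, Real.log_inv]
      field_simp
  · intro x hεx hx1
    have hy : 0 ≤ -Real.log (1 - x) := by
      have := Real.log_nonpos (sub_nonneg.mpr hx1.le) (by linarith)
      linarith
    refine le_trans (le_of_eq ?_) (le_dMaxSmooth (tensorPow_unitary hV n)
      (tensorPow_unitary hV' n) hRn hSn (isState_tensorPow hV hr hr1 n) hsub
      (fun q hq => eq_mul_exp_tensorPow hV hV' hr hs hsupp' d hq) hε0 hεx hx1 (hτ _ hy))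
    congr 1
    simp only [Real.logb, Real.log_inv, one_div]
    field_simp
    ring

end QAEP

end

/-! ### Division by n and the limit. -/

theorem mainTheorem3 {ι : Type*} [Fintype ι] [DecidableEq ι] (ρ σ : Matrix ι ι ℂ)
    (hρ : QAEP.IsState ρ) (hσ : QAEP.IsState σ) (hsupp : QAEP.supp ρ ≤ QAEP.supp σ) :
    (∀ ε ε' : ℝ, 0 < ε → ε < ε' → ε' < 1 → ∀ n : ℕ, 1 ≤ n →
      ((1 / (n : ℝ) : ℝ) : EReal)
          * QAEP.dMaxSmooth ε (QAEP.tensorPow ρ n) (QAEP.tensorPow σ n)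
        ≤ QAEP.relEntropy ρ σ
          + ((1 / √(n : ℝ) * (4 * √2) * Real.logb 2 (QAEP.eta ρ σ)
              * Real.logb 2 ((1 - √(1 - ε ^ 2))⁻¹) : ℝ) : EReal)
      ∧ QAEP.relEntropy ρ σ
          - ((1 / √(n : ℝ) * (4 * √2) * Real.logb 2 (QAEP.eta ρ σ)
              * Real.logb 2 ((1 - ε')⁻¹) : ℝ) : EReal)
          - ((1 / (n : ℝ) * Real.logb 2 (1 / (ε' - ε)) : ℝ) : EReal)
        ≤ ((1 / (n : ℝ) : ℝ) : EReal)
          * QAEP.dMaxSmooth ε (QAEP.tensorPow ρ n) (QAEP.tensorPow σ n))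
    ∧ ∀ ε : ℝ, 0 < ε → ε < 1 →
      Tendsto (fun n : ℕ => ((1 / (n : ℝ) : ℝ) : EReal)
          * QAEP.dMaxSmooth ε (QAEP.tensorPow ρ n) (QAEP.tensorPow σ n))
        atTop (𝓝 (QAEP.relEntropy ρ σ)) := by
  rw [QAEP.relEntropy_eq_coe hsupp]
  have hbd := fun (ε : ℝ) (h0 : 0 < ε) (n : ℕ) (hn : 1 ≤ n) =>
    QAEP.dMaxSmooth_tensorPow_bounds hρ hσ hsupp h0 hn
  generalize (ρ * (QAEP.matLog ρ - QAEP.matLog σ)).trace.re = D at hbd ⊢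
  have hinv : ∀ n : ℕ, (0 : EReal) ≤ ((1 / (n : ℝ) : ℝ) : EReal) := fun n => by
    exact_mod_cast (by positivity : (0 : ℝ) ≤ 1 / (n : ℝ))
  have hsqrt : ∀ n : ℕ, 1 ≤ n → ∀ y : ℝ, 1 / (n : ℝ) * (√n * y) = 1 / √n * y := by
    intro n hn y
    have hn0 : (0 : ℝ) < n := by exact_mod_cast hn
    have h1 := Real.mul_self_sqrt hn0.le
    have h2 : √(n : ℝ) ≠ 0 := (Real.sqrt_pos.mpr hn0).ne'
    nth_rewrite 1 [← h1]
    field_simp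
  have key : ∀ ε ε' : ℝ, 0 < ε → ε < ε' → ε' < 1 → ∀ n : ℕ, 1 ≤ n →
      ((1 / (n : ℝ) : ℝ) : EReal) * QAEP.dMaxSmooth ε (QAEP.tensorPow ρ n) (QAEP.tensorPow σ n)
        ≤ ((D + 1 / √(n : ℝ) * (4 * √2) * Real.logb 2 (QAEP.eta ρ σ)
              * Real.logb 2 ((1 - √(1 - ε ^ 2))⁻¹) : ℝ) : EReal)
      ∧ ((D - 1 / √(n : ℝ) * (4 * √2) * Real.logb 2 (QAEP.eta ρ σ) * Real.logb 2 ((1 - ε')⁻¹)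
          - 1 / (n : ℝ) * Real.logb 2 (1 / (ε' - ε)) : ℝ) : EReal)
        ≤ ((1 / (n : ℝ) : ℝ) : EReal)
          * QAEP.dMaxSmooth ε (QAEP.tensorPow ρ n) (QAEP.tensorPow σ n) := by
    intro ε ε' h0 h1 h2 n hn
    have hn0 : (n : ℝ) ≠ 0 := by
      have : (0 : ℝ) < n := by exact_mod_cast hn
      exact this.ne'
    obtain ⟨hU, hL⟩ := hbd ε h0 n hn
    constructor
    · refine (mul_le_mul_of_nonneg_left (hU (h1.trans h2)) (hinv n)).trans (le_of_eq ?_)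
      rw [← EReal.coe_mul]
      congr 1
      simp only [mul_assoc, mul_add, hsqrt n hn]
      rw [← mul_assoc (1 / (n : ℝ)), one_div_mul_cancel hn0, one_mul]
    · refine le_trans (le_of_eq ?_) (mul_le_mul_of_nonneg_left (hL ε' h1 h2) (hinv n))
      rw [← EReal.coe_mul]
      congr 1
      simp only [mul_assoc, mul_sub, hsqrt n hn]
      rw [← mul_assoc (1 / (n : ℝ)), one_div_mul_cancel hn0, one_mul]
  refine ⟨fun ε ε' h0 h1 h2 n hn => ?_, fun ε h0 h1 => ?_⟩
  · have := key ε ε' h0 h1 h2 n hn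
    rwa [EReal.coe_add, EReal.coe_sub, EReal.coe_sub] at this
  -- Any fixed ε' in (ε, 1) would do; the midpoint is taken, and all correction terms tend to 0.
  · have hk := key ε ((1 + ε) / 2) h0 (by linarith) (by linarith)
    have hs : Tendsto (fun n : ℕ => 1 / √(n : ℝ)) atTop (𝓝 0) := by
      simp only [one_div]
      exact tendsto_inv_atTop_zero.comp
        (Real.tendsto_sqrt_atTop.comp tendsto_natCast_atTop_atTop)
    have hn : Tendsto (fun n : ℕ => 1 / (n : ℝ)) atTop (𝓝 0) := tendsto_one_div_atTop_nhds_zero_nat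
    refine tendsto_of_tendsto_of_tendsto_of_le_of_le'
      (g := fun n : ℕ => ((D - 1 / √(n : ℝ) * (4 * √2) * Real.logb 2 (QAEP.eta ρ σ)
          * Real.logb 2 ((1 - (1 + ε) / 2)⁻¹)
          - 1 / (n : ℝ) * Real.logb 2 (1 / ((1 + ε) / 2 - ε)) : ℝ) : EReal))
      (h := fun n : ℕ => ((D + 1 / √(n : ℝ) * (4 * √2) * Real.logb 2 (QAEP.eta ρ σ)
              * Real.logb 2 ((1 - √(1 - ε ^ 2))⁻¹) : ℝ) : EReal)) ?_ ?_ ?_ ?_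
    · refine (continuous_coe_real_ereal.tendsto D).comp ?_
      have h1 := ((((hs.mul_const (4 * √2)).mul_const (Real.logb 2 (QAEP.eta ρ σ))).mul_const
        (Real.logb 2 ((1 - (1 + ε) / 2)⁻¹))).const_sub D).sub
        (hn.mul_const (Real.logb 2 (1 / ((1 + ε) / 2 - ε))))
      simpa using h1
    · refine (continuous_coe_real_ereal.tendsto D).comp ?_
      have h1 := (((hs.mul_const (4 * √2)).mul_const (Real.logb 2 (QAEP.eta ρ σ))).mul_const
        (Real.logb 2 ((1 - √(1 - ε ^ 2))⁻¹))).const_add D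
      simpa using h1
    · filter_upwards [eventually_ge_atTop 1] with n hn
      exact (hk n hn).2
    · filter_upwards [eventually_ge_atTop 1] with n hn
      exact (hk n hn).1
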